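/- **Setting.** Let $0<q<1$. For $k\ge 1$ put $r=r_k=\lfloor (k+1)/2\rfloor$ and let $\mathcal W_k$ be the set of $\lambda=(\lambda_1\ge\dots\ge\lambda_r)$ with $\lambda_i\in\mathbb N=\{0,1,2,\dots\}$. For vectors $\lambda\in\mathbb N^m$, $\mu\in\mathbb N^{m}$ or $\mathbb N^{m+1}$, write $\lambda\prec\mu$ if $\mu_{i+1}\le\lambda_i$ and $\lambda_i\le\mu_i$ for all $i$ for which these make sense. Let $\{x\}=x$ for integers $x\ge 0$ and $\{x\}=-x-1$ for $x<0$, and let $$R(x,y)=\tfrac{1-q}{1+q}\left(q^{|x-y|}+q^{x+y+1}\right).$$ **The particle system.** Let $\xi^k_i(t)$ ($k\ge1$, $1\le i\le r_k$, $t\in\tfrac12\mathbb N$) be i.i.d. random variables with $\mathbb P(\xi^k_i(t)=x)=(1-q)q^x$, $x\in\mathbb N$. Define $X^k_i(t)$ by $X^k_i(0)=0$ and, for $n\in\mathbb N$, recursively in $k$ (with $X^{k-1}_0=+\infty$): * left jumps: $X^k_i(n+\frac12)=\max\bigl(X^{k-1}_i(n),\ \min(X^k_i(n),X^{k-1}_{i-1}(n+\frac12))-\xi^k_i(n+\frac12)\bigr)$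 if $i\ne\frac{k+1}2$, and $X^k_i(n+\frac12)=\min\bigl(X^k_i(n),X^{k-1}_{i-1}(n+\frac12)\bigr)$ if $i=\frac{k+1}2$ ($k$ odd); * right jumps: $X^k_i(n+1)=\min\bigl(X^{k-1}_{i-1}(n+\frac12),\ \max(X^k_i(n+\frac12),X^{k-1}_i(n+1))+\xi^k_i(n+1)\bigr)$ if $i\neq\frac{k+1}2$, and $X^k_i(n+1)=\min\bigl(\{X^k_i(n+\frac12)+\xi^k_i(n+1)-\xi^k_i(n+\frac12)\},\ X^{k-1}_{i-1}(n+\frac12)\bigr)$ if $i=\frac{k+1}2$ ($k$ odd). Write $X^k(n)=(X^k_1(n),\dots,X^k_{r_k}(n))$ for $n\in\mathbb N$, and for $n\ge1$ let $\widehat X^k(n-\frac12)=(X^k_i(n-\frac12))_{1\le i\le\lfloor k/2\rfloor}$; that is, all particles of level $k$ if $k$ is even, and all but the last particle (the one nearest the wall, which makes no left jump of its own) if $k$ is odd. Put $\widehat X^k(-\frac12)=0$. **The kernels.** With $l_i=\lambda_i+r-i+1$, $m_i=r-i+1$ if $k$ is even, and $l_i=\lambda_i+r-i+\frac12$, $m_i=r-i+\frac12$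 if $k$ is odd, let $$s_k(\lambda)=\prod_{1\le i<j\le r}\frac{l_i^2-l_j^2}{m_i^2-m_j^2}\cdot\begin{cases}\prod_{i=1}^r l_i/m_i,&k\text{ even},\\1,&k\text{ odd}.\end{cases}$$ Let $\mathcal W^{(2)}_k=\{(z,y): y\in\mathcal W_k,\ z\in\mathbb N^{\lfloor k/2\rfloor},\ z\prec y\}$, and for $(z,y),(z',y')\in\mathcal W^{(2)}_k$ let $$S_k((z,y),(z',y'))=(1-q)^{2r}\frac{s_k(y')}{s_k(y)}\,q^{\sum_{i=1}^r(y_i+y_i'-2z_i')}\,1_{z'\prec y,\,y'}\qquad(k=2r),$$ $$S_k((z,y),(z',y'))=(1-q)^{2r-2}\frac{s_k(y')}{s_k(y)}\,R(y_r,y_r')\,q^{\sum_{i=1}^{r-1}(y_i+y_i'-2z_i')}\,1_{z'\prec y,\,y'}\qquad(k=2r-1).$$ For $\lambda,\beta\in\mathcal W_k$ let $$P_{2r}(\lambda,\beta)=\sum_{c\in\mathbb N^r,\ c\prec\lambda,\beta}(1-q)^{2r}\frac{s_{2r}(\beta)}{s_{2r}(\lambda)}q^{\sum_{i=1}^r(\lambda_i+\beta_i-2c_i)},$$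 $$P_{2r-1}(\lambda,\beta)=\sum_{c\in\mathbb N^{r-1},\ c\prec\lambda,\beta}(1-q)^{2r-2}\frac{s_{2r-1}(\beta)}{s_{2r-1}(\lambda)}q^{\sum_{i=1}^{r-1}(\lambda_i+\beta_i-2c_i)}R(\lambda_r,\beta_r).$$ **Theorem.** For each $k\ge1$, $S_k$ is a stochastic matrix on $\mathcal W^{(2)}_k$ and the process $\bigl(\widehat X^k(n-\tfrac12),X^k(n)\bigr)_{n\in\mathbb N}$ is a Markov chain on $\mathcal W^{(2)}_k$ with transition kernel $S_k$. Furthermore, $P_k$ is a stochastic matrix on $\mathcal W_k$ and $(X^k(n))_{n\in\mathbb N}$ is a Markov chain on $\mathcal W_k$ with transition kernel $P_k$. -/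

import Mathlib

open MeasureTheory ProbabilityTheory

/-- A configuration of one level: the positions of its particles, listed from right to left. -/
abbrev Pos (r : ℕ) : Type := Fin r → ℕ

/-- The interlacing relation `lam ≺ mu` for vectors of lengths `m` and `n` (used for `n = m` and
`n = m + 1`): `mu_{i+1} ≤ lam_i` and `lam_i ≤ mu_i` for all possible values of `i`. -/
def Interlace {m n : ℕ} (lam : Pos m) (mu : Pos n) : Prop :=
  (∀ (i : Fin m) (j : Fin n), (j : ℕ) = i → lam i ≤ mu j) ∧
  (∀ (i : Fin m) (j : Fin n), (j : ℕ) = i + 1 → mu j ≤ lam i)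

instance {m n : ℕ} (lam : Pos m) (mu : Pos n) : Decidable (Interlace lam mu) := by
  unfold Interlace; infer_instance

/-- The state space `W_k` of level `k`: weakly decreasing vectors of `⌊(k+1)/2⌋` naturals. -/
def levelSpace (k : ℕ) : Set (Pos ((k + 1) / 2)) := {y | Antitone y}

/-- The state space of the pairs `(z, y)`: `y ∈ W_k` and `z ≺ y`, where `z` has `⌊k/2⌋` entries
(as many as `y` if `k` is even, one fewer if `k` is odd). -/
def pairSpace (k : ℕ) : Set (Pos (k / 2) × Pos ((k + 1) / 2)) :=
  {p | p.2 ∈ levelSpace k ∧ Interlace p.1 p.2}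

/-! ### The explicit kernels -/

/-- `R(x,y) = (1-q)/(1+q) * (q^|x-y| + q^(x+y+1))`. -/
noncomputable def wallKernel (q : ℝ) (x y : ℕ) : ℝ :=
  (1 - q) / (1 + q) * (q ^ ((x : ℤ) - (y : ℤ)).natAbs + q ^ (x + y + 1))

/-- `l_i = lam_i + (r - i) + 1` for even `k`, and the same minus `1/2` for odd `k`, where
`r = ⌊(k+1)/2⌋`. The index `i` of the formula is `i + 1` for `i : Fin r`. -/
noncomputable def shifted (k : ℕ) (lam : Pos ((k + 1) / 2)) (i : Fin ((k + 1) / 2)) : ℝ :=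
  (lam i : ℝ) + ((((k + 1) / 2 : ℕ) : ℝ) - ((i : ℕ) + 1 : ℝ)) + 1 - (if Even k then 0 else 1 / 2)

/-- The function `s_k`. The numbers `m_i` are the `l_i` of the zero vector. -/
noncomputable def sFun (k : ℕ) (lam : Pos ((k + 1) / 2)) : ℝ :=
  (∏ i : Fin ((k + 1) / 2), ∏ j ∈ Finset.Ioi i,
    (shifted k lam i ^ 2 - shifted k lam j ^ 2) / (shifted k 0 i ^ 2 - shifted k 0 j ^ 2)) *
  (if Even k then ∏ i : Fin ((k + 1) / 2), shifted k lam i / shifted k 0 i else 1)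

/-- The weight
`(1-q)^(2⌊k/2⌋) * s_k(y')/s_k(y) * q^(∑_{i ≤ ⌊k/2⌋} (y_i + y'_i - 2 c_i)) * 1_{c ≺ y, c ≺ y'}`,
multiplied for odd `k = 2r-1` by `R(y_r, y'_r)`; here `c` has `⌊k/2⌋` entries. (The last factor
is governed by `k / 2 < (k + 1) / 2`, which holds exactly for odd `k`.) -/
noncomputable def jumpWeight (q : ℝ) (k : ℕ) (y : Pos ((k + 1) / 2)) (c : Pos (k / 2))
    (y' : Pos ((k + 1) / 2)) : ℝ :=
  if Interlace c y ∧ Interlace c y' then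
    (1 - q) ^ (2 * (k / 2)) * (sFun k y' / sFun k y) *
      q ^ (∑ i : Fin (k / 2), ((y (i.castLE (by omega)) : ℤ) + (y' (i.castLE (by omega)) : ℤ)
        - 2 * (c i : ℤ))) *
      (if h : k / 2 < (k + 1) / 2 then wallKernel q (y ⟨k / 2, h⟩) (y' ⟨k / 2, h⟩) else 1)
  else 0

/-- The kernel `S_k((z,y),(z',y'))` on pairs; it does not depend on `z`. -/
noncomputable def kernelS (q : ℝ) (k : ℕ) (p p' : Pos (k / 2) × Pos ((k + 1) / 2)) : ℝ :=
  jumpWeight q k p.2 p'.1 p'.2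

/-- The kernel `P_k(lam, beta)`: the sum of the weights over all `c ∈ ℕ^⌊k/2⌋` with
`c ≺ lam, beta`. The sum is written over the finite box `0 ≤ c_i ≤ lam_i`, which holds all of
them. -/
noncomputable def kernelP (q : ℝ) (k : ℕ) (lam beta : Pos ((k + 1) / 2)) : ℝ :=
  ∑ c ∈ Fintype.piFinset (fun i : Fin (k / 2) => Finset.range (lam (i.castLE (by omega)) + 1)),
    jumpWeight q k lam c beta

/-! ### The particle system

Below, a configuration is a function `x : ℕ → ℕ → ℕ`, where `x k i` is the position of the `i`-th
particle of level `k`; only the values with `1 ≤ i ≤ ⌊(k+1)/2⌋` are meaningful. Time is counted in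
half units: the index `t` stands for time `t/2`. -/

/-- The partial reflection `{x} = x` for `x ≥ 0` and `{x} = -x - 1` for `x < 0`. -/
def partialReflect (x : ℤ) : ℕ := if 0 ≤ x then x.toNat else (-x - 1).toNat

/-- `min(b_{i-1}, x)` for the positions `b_1 ≥ b_2 ≥ …` of the level below, with `b_0 = ∞`. -/
def capBy (b : ℕ → ℕ) (i x : ℕ) : ℕ := if i = 1 then x else min (b (i - 1)) x

/-- The left jumps, from time `n` (configuration `x`) to time `n + 1/2`, with noise
`e = ξ(n+1/2)`. The particle with `i = (k+1)/2` on an odd level `k` is only pushed. (The truncated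
subtraction is harmless because of the maximum with a natural number.) -/
def leftStep (x e : ℕ → ℕ → ℕ) : ℕ → ℕ → ℕ
  | 0, _ => 0
  | k + 1, i =>
    if 2 * i = (k + 1) + 1 then capBy (leftStep x e k) i (x (k + 1) i)
    else max (x k i) (capBy (leftStep x e k) i (x (k + 1) i) - e (k + 1) i)

/-- The right jumps, from time `n + 1/2` (configuration `x`) to time `n + 1`, with noise
`e' = ξ(n+1/2)` and `e = ξ(n+1)`. The particle with `i = (k+1)/2` on an odd level `k` makes the
partially reflected jump. -/
def rightStep (x e' e : ℕ → ℕ → ℕ) : ℕ → ℕ → ℕ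
  | 0, _ => 0
  | k + 1, i =>
    capBy (x k) i
      (if 2 * i = (k + 1) + 1 then
        partialReflect ((x (k + 1) i : ℤ) + (e (k + 1) i : ℤ) - (e' (k + 1) i : ℤ))
      else max (x (k + 1) i) (rightStep x e' e k i) + e (k + 1) i)

/-- The particle system started from all particles at `0`: `particles ξ t k i` is the position
`X^k_i(t/2)`, driven by the noise `ξ t k i = ξ^k_i(t/2)`. -/
def particles (ξ : ℕ → ℕ → ℕ → ℕ) : ℕ → ℕ → ℕ → ℕ
  | 0 => fun _ _ => 0
  | t + 1 =>
    if Even t then leftStep (particles ξ t) (ξ (t + 1))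
    else rightStep (particles ξ t) (ξ t) (ξ (t + 1))

/-- `X^k(n)`, all `⌊(k+1)/2⌋` particles of level `k` at the integer time `n`. -/
def levelAt (ξ : ℕ → ℕ → ℕ → ℕ) (k n : ℕ) : Pos ((k + 1) / 2) :=
  fun i => particles ξ (2 * n) k (i + 1)

/-- `(X^k_i(n - 1/2))` for `1 ≤ i ≤ ⌊k/2⌋`; at `n = 0` it is set to `0`. -/
def halfLevelBefore (ξ : ℕ → ℕ → ℕ → ℕ) (k : ℕ) : ℕ → Pos (k / 2)
  | 0 => fun _ => 0
  | n + 1 => fun i => particles ξ (2 * n + 1) k (i + 1)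

/-- The indices `(t, k, i)` of the noise variables `ξ^k_i(t/2)`: `1 ≤ i ≤ ⌊(k+1)/2⌋` (so `k ≥ 1`). -/
def NoiseIndex : Type := {p : ℕ × ℕ × ℕ // 1 ≤ p.2.2 ∧ p.2.2 ≤ (p.2.1 + 1) / 2}

/-! ### Markov chains -/

/-- `Y` is, under `μ`, a (time-homogeneous) Markov chain with state space `E` and transition
kernel `K`: `K` is a stochastic matrix on `E`, `Y` takes values in `E`, and given
`Y 0 = a 0, …, Y n = a n` the conditional law of `Y (n + 1)` is `K (a n) ·`. -/
structure IsMarkovChain {Ω α : Type*} [MeasurableSpace Ω] [MeasurableSpace α] (μ : Measure Ω)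
    (E : Set α) (K : α → α → ℝ) (Y : ℕ → Ω → α) : Prop where
  nonneg : ∀ a ∈ E, ∀ b ∈ E, 0 ≤ K a b
  hasSum_one : ∀ a ∈ E, HasSum (fun b : E => K a b) 1
  measurable : ∀ n, Measurable (Y n)
  mem : ∀ n, ∀ᵐ ω ∂μ, Y n ω ∈ E
  markov : ∀ (n : ℕ) (a : ℕ → α) (b : α), (∀ j, a j ∈ E) → b ∈ E →
    μ.real {ω | (∀ j ≤ n, Y j ω = a j) ∧ Y (n + 1) ω = b} =
      μ.real {ω | ∀ j ≤ n, Y j ω = a j} * K (a n) b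

/-- The mass at `v` of `max x (m - ξ)` with `ξ` geometric, when `x ≤ m`. -/
noncomputable def leftLaw (q : ℝ) (m x v : ℕ) : ℝ :=
  if x ≤ v ∧ v ≤ m then q ^ (m - v) * (if v = x then 1 else 1 - q) else 0

/-- The mass at `y` of `min u (m + ξ)` with `ξ` geometric, when `m ≤ u`. -/
noncomputable def rightLaw (q : ℝ) (u m y : ℕ) : ℝ :=
  if m ≤ y ∧ y ≤ u then q ^ (y - m) * (if y = u then 1 else 1 - q) else 0

/-- The dependence on the cap `u` of the partially summed transition weights. -/
noncomputable def capWeight (q : ℝ) (y y' u : ℕ) : ℝ :=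
  if y' ≤ u then q ^ (min u y) * (if y' = u then 1 else 1 - q) else 0

/-- The law of the position of a particle at the wall after a partially reflected jump from
`min u y`, capped by `u`. -/
noncomputable def wallLaw (q : ℝ) (u y y' : ℕ) : ℝ :=
  wallKernel q y y' / ((1 - q) * q ^ y) * capWeight q y y' u

section laws
variable {q : ℝ}

theorem wallKernel_of_le {x y : ℕ} (h : x ≤ y) :
    wallKernel q x y = (1 - q) / (1 + q) * (q ^ (y - x) + q ^ (x + y + 1)) := by
  have : ((x : ℤ) - (y : ℤ)).natAbs = y - x := by omega
  rw [wallKernel, this]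

theorem wallKernel_of_ge {x y : ℕ} (h : y ≤ x) :
    wallKernel q x y = (1 - q) / (1 + q) * (q ^ (x - y) + q ^ (x + y + 1)) := by
  have : ((x : ℤ) - (y : ℤ)).natAbs = x - y := by omega
  rw [wallKernel, this]

theorem wallKernel_pos (hq0 : 0 < q) (hq1 : q < 1) (x y : ℕ) : 0 < wallKernel q x y := by
  have : 0 < 1 - q := by linarith
  unfold wallKernel
  positivity

theorem sum_wallKernel (hq0 : 0 < q) (v x' : ℕ) :
    ∑ x ∈ Finset.range v, (1 - q) * wallKernel q x x' + wallKernel q v x' =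
      (1 - q) * q ^ (max v x' - v) := by
  have h1 : 1 + q ≠ 0 := by positivity
  induction v with
  | zero =>
    rw [wallKernel_of_le (Nat.zero_le _)]
    simp
    field_simp
    ring
  | succ v ih =>
    rw [Finset.sum_range_succ]
    have key : wallKernel q (v + 1) x' - q * wallKernel q v x' =
        (1 - q) * q ^ (max (v + 1) x' - (v + 1)) - (1 - q) * q ^ (max v x' - v) := by
      rcases Nat.lt_or_ge v x' with h | h
      · obtain ⟨d, rfl⟩ := Nat.exists_eq_add_of_lt h
        rw [wallKernel_of_le (by omega), wallKernel_of_le (by omega),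
          show v + d + 1 - (v + 1) = d by omega, show v + d + 1 - v = d + 1 by omega,
          show max (v + 1) (v + d + 1) - (v + 1) = d by omega,
          show max v (v + d + 1) - v = d + 1 by omega]
        field_simp
        ring
      · obtain ⟨d, rfl⟩ := Nat.exists_eq_add_of_le h
        rw [wallKernel_of_ge (by omega), wallKernel_of_ge (by omega),
          show x' + d + 1 - x' = d + 1 by omega, show x' + d - x' = d by omega,
          show max (x' + d + 1) x' - (x' + d + 1) = 0 by omega,
          show max (x' + d) x' - (x' + d) = 0 by omega]
        field_simp
        ring
    linarith

theorem sum_capWeight_le (hq0 : 0 < q) (s t b : ℕ) (hb : b ≤ s) :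
    ∑ w ∈ Finset.range (b + 1), ((q ^ w) ^ 2)⁻¹ * capWeight q s t w =
      if t ≤ b then (q ^ b)⁻¹ else 0 := by
  induction b with
  | zero =>
    simp only [capWeight]
    split_ifs <;> simp_all
  | succ b ih =>
    rw [Finset.sum_range_succ, ih (by omega), capWeight, min_eq_left hb]
    have := hq0.ne'
    split_ifs <;> first | omega | skip
    all_goals (try field_simp)
    all_goals (try ring)

theorem sum_pow_mul_sum_capWeight (hq0 : 0 < q) (s t x' v : ℕ) (hv : s ≤ v) :
    ∑ x ∈ Finset.Ico s v, (1 - q) * (q ^ x * ∑ w ∈ Finset.range (min x x' + 1),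
        ((q ^ w) ^ 2)⁻¹ * capWeight q s t w) +
      q ^ v * ∑ w ∈ Finset.range (min v x' + 1), ((q ^ w) ^ 2)⁻¹ * capWeight q s t w =
      if t ≤ min v x' then q ^ s * (q ^ (min v x'))⁻¹ else 0 := by
  induction v, hv using Nat.le_induction with
  | base =>
    rw [sum_capWeight_le hq0 _ _ _ (min_le_left _ _)]
    simp
  | succ v hv ih =>
    have hq := hq0.ne'
    rw [Finset.sum_Ico_succ_top hv]
    rcases Nat.lt_or_ge v x' with h | h
    · rw [min_eq_left h.le] at ih ⊢
      rw [min_eq_left (Nat.succ_le_of_lt h), Finset.sum_range_succ _ (v + 1)]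
      rw [← eq_sub_iff_add_eq] at ih
      rw [capWeight, min_eq_right (by omega : s ≤ v + 1)]
      have : (if t ≤ v then q ^ s * (q ^ v)⁻¹ else 0) + q ^ (v + 1) * (((q ^ (v + 1)) ^ 2)⁻¹ *
          (if t ≤ v + 1 then q ^ s * (if t = v + 1 then 1 else 1 - q) else 0)) =
          if t ≤ v + 1 then q ^ s * (q ^ (v + 1))⁻¹ else 0 := by
        split_ifs <;> first | omega | skip
        all_goals (try field_simp)
        all_goals (try ring)
      rw [Nat.succ_eq_add_one, ← this, ih]
      ring
    · rw [min_eq_right h] at ih ⊢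
      rw [min_eq_right (by omega : x' ≤ v + 1), ← ih]
      ring

/-- Summation over the positions `x` of one particle of the lower level at an integer time and
`w` of its next half-time position. -/
theorem sum_leftLaw_rightLaw (hq0 : 0 < q) (N s t x' y y' v U : ℕ) (hN : y < N) :
    ∑ x ∈ Finset.range N, ∑ w ∈ Finset.range N,
      ((if s ≤ x ∧ w ≤ x ∧ w ≤ x' then q ^ x * q ^ x' * ((q ^ w) ^ 2)⁻¹ else 0) *
        (leftLaw q (min U y) x v * rightLaw q U (max v x') y')) * capWeight q s t w =
      (if (s ≤ v ∧ v ≤ y ∧ t ≤ v ∧ v ≤ y') ∧ t ≤ x' ∧ x' ≤ y' then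
        q ^ s * q ^ y' * ((q ^ v) ^ 2)⁻¹ else 0) * capWeight q y y' U := by
  have hq := hq0.ne'
  have inner : ∀ x ∈ Finset.range N, ∑ w ∈ Finset.range N,
      ((if s ≤ x ∧ w ≤ x ∧ w ≤ x' then q ^ x * q ^ x' * ((q ^ w) ^ 2)⁻¹ else 0) *
        (leftLaw q (min U y) x v * rightLaw q U (max v x') y')) * capWeight q s t w =
      (if s ≤ x then q ^ x * ∑ w ∈ Finset.range (min x x' + 1),
        ((q ^ w) ^ 2)⁻¹ * capWeight q s t w else 0) * leftLaw q (min U y) x v *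
        (q ^ x' * rightLaw q U (max v x') y') := by
    intro x hx
    rw [Finset.mem_range] at hx
    by_cases hs : s ≤ x
    · have hsub : Finset.range (min x x' + 1) ⊆ Finset.range N :=
        Finset.range_subset_range.2 (by omega)
      rw [if_pos hs, ← Finset.sum_subset hsub, Finset.mul_sum, Finset.sum_mul, Finset.sum_mul]
      · refine Finset.sum_congr rfl fun w hw => ?_
        rw [Finset.mem_range] at hw
        rw [if_pos (by omega)]
        ring
      · intro w _ hw
        rw [Finset.mem_range] at hw
        rw [if_neg (by omega)]
        ring
    · simp [hs]
  rw [Finset.sum_congr rfl inner, ← Finset.sum_mul]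
  by_cases hv : s ≤ v ∧ v ≤ min U y
  · obtain ⟨hsv, hvm⟩ := hv
    have : ∑ x ∈ Finset.range N, (if s ≤ x then q ^ x * ∑ w ∈ Finset.range (min x x' + 1),
        ((q ^ w) ^ 2)⁻¹ * capWeight q s t w else 0) * leftLaw q (min U y) x v =
        q ^ (min U y - v) * (if t ≤ min v x' then q ^ s * (q ^ (min v x'))⁻¹ else 0) := by
      have hsub : Finset.Ico s (v + 1) ⊆ Finset.range N := by
        intro x; simp only [Finset.mem_Ico, Finset.mem_range]; omega
      rw [← sum_pow_mul_sum_capWeight hq0 s t x' v hsv, ← Finset.sum_subset hsub,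
        Finset.sum_Ico_succ_top hsv, mul_add, Finset.mul_sum (Finset.Ico s v)]
      · congr 1
        · refine Finset.sum_congr rfl fun x hx => ?_
          rw [Finset.mem_Ico] at hx
          rw [if_pos hx.1, leftLaw, if_pos (by omega), if_neg (by omega)]
          ring
        · rw [if_pos hsv, leftLaw, if_pos (by omega), if_pos rfl]
          ring
      · intro x _ hx
        rw [Finset.mem_Ico] at hx
        by_cases h : s ≤ x
        · rw [leftLaw, if_neg (by omega : ¬ (x ≤ v ∧ v ≤ min U y)), mul_zero]
        · rw [if_neg h, zero_mul]
    rw [this, capWeight, rightLaw]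
    by_cases hc : t ≤ min v x' ∧ max v x' ≤ y' ∧ y' ≤ U
    · obtain ⟨h1, h2, h3⟩ := hc
      rw [if_pos h1, if_pos ⟨h2, h3⟩, if_pos h3,
        if_pos (by omega : (s ≤ v ∧ v ≤ y ∧ t ≤ v ∧ v ≤ y') ∧ t ≤ x' ∧ x' ≤ y')]
      have e1 : q ^ x' = q ^ min v x' * q ^ (max v x' - v) := by
        rw [← pow_add]; congr 1; omega
      have e2 : q ^ y' = q ^ v * q ^ (max v x' - v) * q ^ (y' - max v x') := by
        rw [← pow_add, ← pow_add]; congr 1; omega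
      have e3 : q ^ min U y = q ^ v * q ^ (min U y - v) := by
        rw [← pow_add]; congr 1; omega
      rw [e1, e2, e3]
      field_simp
    · split_ifs <;> first | omega | simp
  · rw [Finset.sum_eq_zero, zero_mul, capWeight]
    · split_ifs <;> first | omega | simp
    · intro x _
      rw [leftLaw]
      split_ifs <;> first | omega | simp

/-- Summation over the position `x` of the wall particle of the lower level. -/
theorem sum_wallKernel_leftLaw_rightLaw (hq0 : 0 < q) (N x' y y' v U : ℕ) (hN : y < N) :
    ∑ x ∈ Finset.range N, wallKernel q x x' *
        (leftLaw q (min U y) x v * rightLaw q U (max v x') y') =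
      (if (v ≤ y ∧ v ≤ y') ∧ x' ≤ y' then (1 - q) * q ^ y' * ((q ^ v) ^ 2)⁻¹ else 0) *
        capWeight q y y' U := by
  have hq := hq0.ne'
  by_cases hvm : v ≤ min U y
  · have : ∑ x ∈ Finset.range N, wallKernel q x x' * leftLaw q (min U y) x v =
        q ^ (min U y - v) * ((1 - q) * q ^ (max v x' - v)) := by
      have hsub : Finset.range (v + 1) ⊆ Finset.range N :=
        Finset.range_subset_range.2 (by omega)
      rw [← sum_wallKernel hq0, ← Finset.sum_subset hsub, Finset.sum_range_succ, mul_add,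
        Finset.mul_sum]
      · congr 1
        · refine Finset.sum_congr rfl fun x hx => ?_
          rw [Finset.mem_range] at hx
          rw [leftLaw, if_pos (by omega), if_neg (by omega)]
          ring
        · rw [leftLaw, if_pos (by omega), if_pos rfl]
          ring
      · intro x _ hx
        rw [Finset.mem_range] at hx
        rw [leftLaw, if_neg (by omega), mul_zero]
    simp_rw [← mul_assoc]
    rw [← Finset.sum_mul, this, capWeight, rightLaw]
    by_cases hc : max v x' ≤ y' ∧ y' ≤ U
    · obtain ⟨h2, h3⟩ := hc
      rw [if_pos ⟨h2, h3⟩, if_pos h3, if_pos (by omega : (v ≤ y ∧ v ≤ y') ∧ x' ≤ y')]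
      have e2 : q ^ y' = q ^ v * q ^ (max v x' - v) * q ^ (y' - max v x') := by
        rw [← pow_add, ← pow_add]; congr 1; omega
      have e3 : q ^ min U y = q ^ v * q ^ (min U y - v) := by
        rw [← pow_add]; congr 1; omega
      rw [e2, e3]
      field_simp
    · split_ifs <;> first | omega | simp
  · rw [Finset.sum_eq_zero, capWeight]
    · split_ifs <;> first | omega | simp
    · intro x _
      rw [leftLaw]
      split_ifs <;> first | omega | simp

end laws

/-- Evaluation of a sum over two interlaced sequences of summation variables, by summing out the
variables from the last one to the first one. -/
theorem sum_chain (N : ℕ) (a : ℕ) (F : ℕ → ℕ → ℕ → ℕ → ℝ) (h : ℕ → ℕ → ℝ)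
    (hrec : ∀ i < a, ∀ U, ∑ x ∈ Finset.range N, ∑ w ∈ Finset.range N, F i U x w * h (i + 1) w =
      h i U) (U : ℕ) :
    ∑ x ∈ Fintype.piFinset (fun _ : Fin a => Finset.range N),
      ∑ u ∈ Fintype.piFinset (fun _ : Fin a => Finset.range N),
        (∏ i : Fin a, F i ((Fin.cons U u : Fin (a + 1) → ℕ) i.castSucc) (x i) (u i)) *
          h a ((Fin.cons U u : Fin (a + 1) → ℕ) (Fin.last a)) = h 0 U := by
  induction a generalizing F h U with
  | zero => simp
  | succ a ih =>
    have split : ∀ f : (Fin (a + 1) → ℕ) → ℝ,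
        ∑ x ∈ Fintype.piFinset (fun _ : Fin (a + 1) => Finset.range N), f x =
        ∑ t ∈ Finset.range N, ∑ x ∈ Fintype.piFinset (fun _ : Fin a => Finset.range N),
          f (Fin.cons t x) := by
      intro f
      rw [← Finset.sum_product']
      refine Finset.sum_nbij' (fun x => (x 0, Fin.tail x)) (fun p => Fin.cons p.1 p.2)
        ?_ ?_ ?_ ?_ ?_
      · intro x hx
        simp only [Fintype.mem_piFinset, Finset.mem_product, Fin.tail] at hx ⊢
        exact ⟨hx 0, fun i => hx _⟩
      · intro p hp
        simp only [Fintype.mem_piFinset, Finset.mem_product] at hp ⊢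
        exact Fin.cases hp.1 hp.2
      · intro x _; simp
      · intro p _; simp
      · intro x _; simp
    have hstep := ih (fun i => F (i + 1)) (fun i => h (i + 1))
      (fun i hi U => hrec (i + 1) (by omega) U)
    rw [split, ← hrec 0 (by omega) U]
    refine Finset.sum_congr rfl fun x _ => ?_
    simp_rw [split]
    rw [Finset.sum_comm]
    refine Finset.sum_congr rfl fun w _ => ?_
    rw [← hstep w, Finset.mul_sum]
    refine Finset.sum_congr rfl fun xs _ => ?_
    rw [Finset.mul_sum]
    refine Finset.sum_congr rfl fun us _ => ?_
    rw [Fin.prod_univ_succ]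
    have e : ∀ i : Fin a, (Fin.cons U (Fin.cons w us : Fin (a + 1) → ℕ) : Fin (a + 1 + 1) → ℕ)
        i.succ.castSucc = (Fin.cons w us : Fin (a + 1) → ℕ) i.castSucc := by
      intro i
      rw [← Fin.succ_castSucc, Fin.cons_succ]
    have e' : (Fin.cons U (Fin.cons w us : Fin (a + 1) → ℕ) : Fin (a + 1 + 1) → ℕ)
        (Fin.last (a + 1)) = (Fin.cons w us : Fin (a + 1) → ℕ) (Fin.last a) := by
      rw [← Fin.succ_last, Fin.cons_succ]
    simp only [e, e', Fin.cons_succ, Fin.castSucc_zero, Fin.cons_zero, Fin.val_succ, Fin.val_zero]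
    ring

/-- The entries of a configuration as a sequence, continued by zeros. -/
def entry {n : ℕ} (y : Pos n) (i : ℕ) : ℕ := if h : i < n then y ⟨i, h⟩ else 0

theorem entry_of_lt {n : ℕ} (y : Pos n) {i : ℕ} (h : i < n) : entry y i = y ⟨i, h⟩ := dif_pos h

@[simp] theorem entry_val {n : ℕ} (y : Pos n) (i : Fin n) : entry y i = y i := dif_pos i.2

theorem interlace_iff {m n : ℕ} (lam : Pos m) (mu : Pos n) :
    Interlace lam mu ↔ (∀ i, i < m → i < n → entry lam i ≤ entry mu i) ∧
      (∀ i, i < m → i + 1 < n → entry mu (i + 1) ≤ entry lam i) := by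
  constructor
  · rintro ⟨h1, h2⟩
    refine ⟨fun i hm hn => ?_, fun i hm hn => ?_⟩
    · rw [entry_of_lt _ hm, entry_of_lt _ hn]
      exact h1 ⟨i, hm⟩ ⟨i, hn⟩ rfl
    · rw [entry_of_lt _ hm, entry_of_lt _ hn]
      exact h2 ⟨i, hm⟩ ⟨i + 1, hn⟩ rfl
  · rintro ⟨h1, h2⟩
    refine ⟨fun i j h => ?_, fun i j h => ?_⟩
    · have := h1 i i.2 (h ▸ j.2)
      rwa [entry_val, ← h, entry_val] at this
    · have := h2 i i.2 (h ▸ j.2)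
      rw [← h] at this
      simpa using this

/-- The factor of `jumpWeight` without the ratio of the functions `sFun`. -/
noncomputable def levelWeight (q : ℝ) {a b : ℕ} (y : Pos b) (c : Pos a) (y' : Pos b) : ℝ :=
  if Interlace c y ∧ Interlace c y' then
    (1 - q) ^ (2 * a) *
      (∏ i ∈ Finset.range a, q ^ entry y i * q ^ entry y' i * ((q ^ entry c i) ^ 2)⁻¹) *
      (if a < b then wallKernel q (entry y a) (entry y' a) else 1)
  else 0

theorem jumpWeight_eq {q : ℝ} (hq0 : 0 < q) (k : ℕ) (y : Pos ((k + 1) / 2)) (c : Pos (k / 2))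
    (y' : Pos ((k + 1) / 2)) :
    jumpWeight q k y c y' = sFun k y' / sFun k y * levelWeight q y c y' := by
  have hs : ∀ (s : Finset (Fin (k / 2))) (f : Fin (k / 2) → ℤ),
      q ^ (∑ i ∈ s, f i) = ∏ i ∈ s, q ^ f i := by
    intro s f
    induction s using Finset.cons_induction with
    | empty => simp
    | cons i s hi ih => rw [Finset.sum_cons, Finset.prod_cons, zpow_add₀ hq0.ne', ih]
  have hterm : ∀ i : Fin (k / 2), q ^ ((y (i.castLE (by omega)) : ℤ) +
      (y' (i.castLE (by omega)) : ℤ) - 2 * (c i : ℤ)) =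
      q ^ entry y i * q ^ entry y' i * ((q ^ entry c i) ^ 2)⁻¹ := by
    intro i
    rw [entry_of_lt y (by omega : (i : ℕ) < _), entry_of_lt y' (by omega : (i : ℕ) < _),
      entry_val, zpow_sub₀ hq0.ne', zpow_add₀ hq0.ne', mul_comm (2 : ℤ), zpow_mul]
    simp only [zpow_natCast, div_eq_mul_inv]
    rfl
  unfold jumpWeight levelWeight
  simp_rw [hs, hterm, Finset.prod_range]
  split_ifs with h h1
  · rw [entry_of_lt y h1, entry_of_lt y' h1]
    ring
  · ring
  · simp

/-- The bound `u_{i-1}` on the particle `i`, with `u_{-1} = N`. -/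
def capAt (N : ℕ) (u : ℕ → ℕ) (i : ℕ) : ℕ := if i = 0 then N else u (i - 1)

/-- The law of the new positions of the particle `i` of the upper level, given the two lower-level
positions `x`, `x'` at the integer times and the cap `U` at the half time. It is a wall particle
if `b ≤ i`. -/
noncomputable def particleLaw (q : ℝ) (b : ℕ) (x x' y v y' : ℕ → ℕ) (i U : ℕ) : ℝ :=
  if i < b then leftLaw q (min U (y i)) (x i) (v i) * rightLaw q U (max (v i) (x' i)) (y' i)
  else wallLaw q U (y i) (y' i)

/-- The transition law of the upper level given that of the lower level. -/
noncomputable def transLaw (q : ℝ) (N : ℕ) {a b c : ℕ} (x : Pos b) (u : Pos a) (x' : Pos b)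
    (y : Pos c) (v : Pos b) (y' : Pos c) : ℝ :=
  ∏ i ∈ Finset.range c, particleLaw q b (entry x) (entry x') (entry y) (entry v) (entry y') i
    (capAt N (entry u) i)

/-- The factor that belongs to one pair of summation variables. -/
noncomputable def chainTerm (q : ℝ) (x' y y' v : ℕ → ℕ) (i U x w : ℕ) : ℝ :=
  (if y (i + 1) ≤ x ∧ w ≤ x ∧ w ≤ x' i then q ^ x * q ^ x' i * ((q ^ w) ^ 2)⁻¹ else 0) *
    (leftLaw q (min U (y i)) x (v i) * rightLaw q U (max (v i) (x' i)) (y' i))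

section chain
variable {q : ℝ}

theorem le_of_leftLaw_ne_zero {m x v : ℕ} (h : leftLaw q m x v ≠ 0) : x ≤ v ∧ v ≤ m := by
  by_contra hc
  exact h (if_neg hc)

theorem le_of_rightLaw_ne_zero {u m y : ℕ} (h : rightLaw q u m y ≠ 0) : m ≤ y ∧ y ≤ u := by
  by_contra hc
  exact h (if_neg hc)

theorem sum_chainTerm (hq0 : 0 < q) (a N : ℕ) (x' y y' v : ℕ → ℕ) (hy : ∀ i, y i < N)
    (hy' : ∀ i, y' i < N) (A : ℝ) :
    ∑ x ∈ Fintype.piFinset (fun _ : Fin a => Finset.range N),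
      ∑ u ∈ Fintype.piFinset (fun _ : Fin a => Finset.range N),
        (∏ i ∈ Finset.range a, chainTerm q x' y y' v i (capAt N (entry u) i) (entry x i)
          (entry u i)) * (A * capWeight q (y a) (y' a) (capAt N (entry u) a)) =
      A * (∏ i ∈ Finset.range a, if (y (i + 1) ≤ v i ∧ v i ≤ y i ∧ y' (i + 1) ≤ v i ∧ v i ≤ y' i) ∧
        y' (i + 1) ≤ x' i ∧ x' i ≤ y' i then q ^ y (i + 1) * q ^ y' i * ((q ^ v i) ^ 2)⁻¹ else 0) *
        (q ^ y 0 * (1 - q)) := by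
  set C : ℕ → ℝ := fun i => if (y (i + 1) ≤ v i ∧ v i ≤ y i ∧ y' (i + 1) ≤ v i ∧ v i ≤ y' i) ∧
        y' (i + 1) ≤ x' i ∧ x' i ≤ y' i then q ^ y (i + 1) * q ^ y' i * ((q ^ v i) ^ 2)⁻¹ else 0
    with hC
  have := sum_chain N a (chainTerm q x' y y' v)
    (fun i U => A * (∏ j ∈ Finset.Ico i a, C j) * capWeight q (y i) (y' i) U) ?_ N
  · rw [show capWeight q (y 0) (y' 0) N = q ^ y 0 * (1 - q) by
      rw [capWeight, if_pos (hy' 0).le, min_eq_right (hy 0).le, if_neg (hy' 0).ne]] at this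
    rw [← Finset.range_eq_Ico] at this
    rw [← this]
    refine Finset.sum_congr rfl fun x _ => Finset.sum_congr rfl fun u _ => ?_
    rw [Finset.prod_range, Finset.Ico_self, Finset.prod_empty, mul_one]
    have cap : ∀ i : Fin (a + 1), (Fin.cons N u : Fin (a + 1) → ℕ) i = capAt N (entry u) i := by
      intro i
      refine Fin.cases ?_ (fun j => ?_) i
      · rfl
      · simp [capAt]
    simp only [cap, entry_val, Fin.val_castSucc, Fin.val_last]
  · intro i hi U
    have := sum_leftLaw_rightLaw hq0 N (y (i + 1)) (y' (i + 1)) (x' i) (y i) (y' i) (v i) U (hy i)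
    rw [Finset.prod_eq_prod_Ico_succ_bot hi, mul_comm (C i), ← mul_assoc A,
      mul_assoc _ (C i), show C i * capWeight q (y i) (y' i) U = _ from this.symm]
    simp_rw [Finset.mul_sum]
    refine Finset.sum_congr rfl fun x _ => Finset.sum_congr rfl fun w _ => ?_
    rw [chainTerm]
    ring

theorem weight_mul_transLaw (N : ℕ) {a b c : ℕ} (hb : b = a ∨ b = a + 1) (hc : c = a + 1)
    (x : Pos b) (u : Pos a) (x' : Pos b) (y : Pos c) (v : Pos b) (y' : Pos c) :
    (if Interlace x y then levelWeight q x u x' * transLaw q N x u x' y v y' else 0) =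
      (1 - q) ^ (2 * a) * ((∏ i ∈ Finset.range a, chainTerm q (entry x') (entry y) (entry y')
        (entry v) i (capAt N (entry u) i) (entry x i) (entry u i)) *
        ((if a < b then wallKernel q (entry x a) (entry x' a) else 1) *
          particleLaw q b (entry x) (entry x') (entry y) (entry v) (entry y') a
            (capAt N (entry u) a))) := by
  by_cases h : Interlace x y ∧ Interlace u x ∧ Interlace u x'
  · obtain ⟨h1, h2, h3⟩ := h
    subst hc
    rw [if_pos h1, levelWeight, if_pos ⟨h2, h3⟩, transLaw, Finset.prod_range_succ]
    have : ∀ i ∈ Finset.range a, chainTerm q (entry x') (entry y) (entry y')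
        (entry v) i (capAt N (entry u) i) (entry x i) (entry u i) =
        (q ^ entry x i * q ^ entry x' i * ((q ^ entry u i) ^ 2)⁻¹) * particleLaw q b (entry x)
          (entry x') (entry y) (entry v) (entry y') i (capAt N (entry u) i) := by
      intro i hi
      rw [Finset.mem_range] at hi
      rw [interlace_iff] at h1 h2 h3
      rw [chainTerm, particleLaw, if_pos (by omega : i < b), if_pos]
      exact ⟨h1.2 i (by omega) (by omega), h2.1 i hi (by omega), h3.1 i hi (by omega)⟩
    rw [Finset.prod_congr rfl this, Finset.prod_mul_distrib (g := fun i => particleLaw q b _ _ _ _ _ i _)]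
    ring
  · have hl : (if Interlace x y then levelWeight q x u x' * transLaw q N x u x' y v y' else 0) =
        0 := by
      by_cases h1 : Interlace x y
      · rw [if_pos h1, levelWeight, if_neg (fun h2 => h ⟨h1, h2⟩), zero_mul]
      · rw [if_neg h1]
    rw [hl]
    by_contra hne
    obtain ⟨-, hne⟩ := mul_ne_zero_iff.1 (Ne.symm hne)
    obtain ⟨hp, hne⟩ := mul_ne_zero_iff.1 hne
    obtain ⟨-, hlast⟩ := mul_ne_zero_iff.1 hne
    rw [Finset.prod_ne_zero_iff] at hp
    have hchain : ∀ i < a, entry y (i + 1) ≤ entry x i ∧ entry u i ≤ entry x i ∧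
        entry u i ≤ entry x' i := by
      intro i hi
      have := left_ne_zero_of_mul (hp i (Finset.mem_range.2 hi))
      by_contra hc
      exact this (if_neg hc)
    have hlaw : ∀ i < b, (entry x i ≤ entry v i ∧
        entry v i ≤ min (capAt N (entry u) i) (entry y i)) ∧
        (max (entry v i) (entry x' i) ≤ entry y' i ∧ entry y' i ≤ capAt N (entry u) i) := by
      intro i hi
      have key : leftLaw q (min (capAt N (entry u) i) (entry y i)) (entry x i) (entry v i) *
          rightLaw q (capAt N (entry u) i) (max (entry v i) (entry x' i)) (entry y' i) ≠ 0 := by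
        rcases Nat.lt_or_ge i a with h | h
        · exact right_ne_zero_of_mul (hp i (Finset.mem_range.2 h))
        · obtain rfl : i = a := by omega
          rwa [particleLaw, if_pos hi] at hlast
      exact ⟨le_of_leftLaw_ne_zero (left_ne_zero_of_mul key),
        le_of_rightLaw_ne_zero (right_ne_zero_of_mul key)⟩
    have hcap : ∀ i, capAt N (entry u) (i + 1) = entry u i := fun i => rfl
    refine h ⟨?_, ?_, ?_⟩ <;> rw [interlace_iff]
    · exact ⟨fun i hi _ => by have := hlaw i hi; omega, fun i hi h => (hchain i (by omega)).1⟩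
    · refine ⟨fun i hi _ => (hchain i hi).2.1, fun i hi hj => ?_⟩
      have := hlaw (i + 1) hj
      rw [hcap] at this
      omega
    · refine ⟨fun i hi _ => (hchain i hi).2.2, fun i hi hj => ?_⟩
      have := hlaw (i + 1) hj
      rw [hcap] at this
      omega

theorem sum_piFinset_snoc (a N : ℕ) (f : Pos (a + 1) → ℝ) :
    ∑ x ∈ Fintype.piFinset (fun _ : Fin (a + 1) => Finset.range N), f x =
      ∑ x ∈ Fintype.piFinset (fun _ : Fin a => Finset.range N), ∑ t ∈ Finset.range N,
        f (Fin.snoc x t) := by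
  rw [← Finset.sum_product']
  refine Finset.sum_nbij' (fun x => (Fin.init x, x (Fin.last a)))
    (fun p => Fin.snoc (α := fun _ => ℕ) p.1 p.2) ?_ ?_ ?_ ?_ ?_
  · intro x hx
    simp only [Fintype.mem_piFinset, Finset.mem_product, Fin.init] at hx ⊢
    exact ⟨fun i => hx _, hx _⟩
  · intro p hp
    simp only [Fintype.mem_piFinset, Finset.mem_product] at hp ⊢
    intro i
    refine Fin.lastCases ?_ (fun j => ?_) i
    · simpa using hp.2
    · simpa using hp.1 j
  · intro x _; simp
  · intro p _; simp
  · intro x _; simp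

theorem entry_snoc_of_lt {a : ℕ} (x : Pos a) (t : ℕ) {i : ℕ} (hi : i < a) :
    entry (Fin.snoc x t : Pos (a + 1)) i = entry x i := by
  rw [entry_of_lt _ (by omega : i < a + 1), entry_of_lt _ hi]
  exact Fin.snoc_castSucc (α := fun _ => ℕ) t x ⟨i, hi⟩

theorem entry_snoc_last {a : ℕ} (x : Pos a) (t : ℕ) :
    entry (Fin.snoc x t : Pos (a + 1)) a = t := by
  rw [entry_of_lt _ (by omega : a < a + 1)]
  exact Fin.snoc_last (α := fun _ => ℕ) t x

theorem prod_range_shift (a : ℕ) (f g h : ℕ → ℝ) :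
    (∏ i ∈ Finset.range a, f (i + 1) * g i * h i) * f 0 =
      (∏ i ∈ Finset.range a, f i * g i * h i) * f a := by
  simp_rw [Finset.prod_mul_distrib]
  have := Finset.prod_range_succ' f a
  rw [Finset.prod_range_succ] at this
  linear_combination (-(∏ i ∈ Finset.range a, g i) * (∏ i ∈ Finset.range a, h i)) * this

/-- The intertwining of the weights of two consecutive levels. -/
theorem sum_weight_mul_transLaw (hq0 : 0 < q) (hq1 : q < 1) (N : ℕ) {a b c : ℕ}
    (hb : b = a ∨ b = a + 1)
    (hc : c = a + 1) (x' : Pos b) (y : Pos c) (v : Pos b) (y' : Pos c)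
    (hy : ∀ i, entry y i < N) (hy' : ∀ i, entry y' i < N) :
    ∑ x ∈ Fintype.piFinset (fun _ : Fin b => Finset.range N),
      ∑ u ∈ Fintype.piFinset (fun _ : Fin a => Finset.range N),
      (if Interlace x y then levelWeight q x u x' * transLaw q N x u x' y v y' else 0) =
      levelWeight q y v y' * (if Interlace x' y' then 1 else 0) := by
  simp_rw [weight_mul_transLaw N hb hc]
  have hq := hq0.ne'
  have hq1' : 1 - q ≠ 0 := by linarith
  rcases hb with rfl | rfl
  · simp only [lt_irrefl, if_false, one_mul, particleLaw, wallLaw]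
    simp_rw [← Finset.mul_sum]
    rw [sum_chainTerm hq0 b N _ _ _ _ hy hy', Finset.prod_ite_zero]
    subst hc
    rw [levelWeight]
    have iff : (∀ i ∈ Finset.range b, (entry y (i + 1) ≤ entry v i ∧ entry v i ≤ entry y i ∧
        entry y' (i + 1) ≤ entry v i ∧ entry v i ≤ entry y' i) ∧
        entry y' (i + 1) ≤ entry x' i ∧ entry x' i ≤ entry y' i) ↔
        (Interlace v y ∧ Interlace v y') ∧ Interlace x' y' := by
      simp only [interlace_iff, Finset.mem_range]
      constructor
      · intro h
        exact ⟨⟨⟨fun i hi _ => (h i hi).1.2.1, fun i hi _ => (h i hi).1.1⟩,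
          ⟨fun i hi _ => (h i hi).1.2.2.2, fun i hi _ => (h i hi).1.2.2.1⟩⟩,
          ⟨fun i hi _ => (h i hi).2.2, fun i hi _ => (h i hi).2.1⟩⟩
      · rintro ⟨⟨h1, h2⟩, h3⟩ i hi
        exact ⟨⟨h1.2 i hi (by omega), h1.1 i hi (by omega), h2.2 i hi (by omega),
          h2.1 i hi (by omega)⟩, h3.2 i hi (by omega), h3.1 i hi (by omega)⟩
    by_cases h : (Interlace v y ∧ Interlace v y') ∧ Interlace x' y'
    · rw [if_pos (iff.2 h), if_pos h.1, if_pos h.2, if_pos (by omega : b < b + 1)]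
      have := prod_range_shift b (fun i => q ^ entry y i) (fun i => q ^ entry y' i)
        (fun i => ((q ^ entry v i) ^ 2)⁻¹)
      rw [← mul_assoc (_ * _) (q ^ entry y 0), mul_assoc _ (∏ i ∈ Finset.range b, _), this]
      field_simp
    · rw [if_neg (fun h' => h (iff.1 h'))]
      rw [not_and_or] at h
      rcases h with h | h <;> simp [h]
  · have step : ∀ (x u : Pos a), ∑ t ∈ Finset.range N,
        (1 - q) ^ (2 * a) * ((∏ i ∈ Finset.range a, chainTerm q (entry x') (entry y) (entry y')
        (entry v) i (capAt N (entry u) i) (entry (Fin.snoc x t : Pos (a + 1)) i) (entry u i)) *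
        ((if a < a + 1 then wallKernel q (entry (Fin.snoc x t : Pos (a + 1)) a) (entry x' a) else 1) *
          particleLaw q (a + 1) (entry (Fin.snoc x t : Pos (a + 1))) (entry x') (entry y) (entry v)
          (entry y') a (capAt N (entry u) a))) =
        (1 - q) ^ (2 * a) * ((∏ i ∈ Finset.range a, chainTerm q (entry x') (entry y) (entry y')
        (entry v) i (capAt N (entry u) i) (entry x i) (entry u i)) *
        ((if (entry v a ≤ entry y a ∧ entry v a ≤ entry y' a) ∧ entry x' a ≤ entry y' a then
          (1 - q) * q ^ entry y' a * ((q ^ entry v a) ^ 2)⁻¹ else 0) *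
          capWeight q (entry y a) (entry y' a) (capAt N (entry u) a))) := by
      intro x u
      rw [← Finset.mul_sum, ← sum_wallKernel_leftLaw_rightLaw hq0 N _ _ _ _ _ (hy a)]
      congr 1
      rw [Finset.mul_sum]
      refine Finset.sum_congr rfl fun t _ => ?_
      rw [if_pos (by omega), particleLaw, if_pos (by omega), entry_snoc_last]
      congr 1
      refine Finset.prod_congr rfl fun i hi => ?_
      rw [entry_snoc_of_lt _ _ (Finset.mem_range.1 hi)]
    rw [sum_piFinset_snoc]
    have step2 : ∀ (x : Pos a), ∑ t ∈ Finset.range N, ∑ u ∈ Fintype.piFinset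
        (fun _ : Fin a => Finset.range N), _ = _ := fun x =>
      Finset.sum_comm.trans (Finset.sum_congr rfl fun u _ => step x u)
    simp_rw [step2, ← Finset.mul_sum]
    rw [sum_chainTerm hq0 a N _ _ _ _ hy hy', Finset.prod_ite_zero]
    subst hc
    rw [levelWeight]
    have iff : ((∀ i ∈ Finset.range a, (entry y (i + 1) ≤ entry v i ∧ entry v i ≤ entry y i ∧
        entry y' (i + 1) ≤ entry v i ∧ entry v i ≤ entry y' i) ∧
        entry y' (i + 1) ≤ entry x' i ∧ entry x' i ≤ entry y' i) ∧
        (entry v a ≤ entry y a ∧ entry v a ≤ entry y' a) ∧ entry x' a ≤ entry y' a) ↔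
        (Interlace v y ∧ Interlace v y') ∧ Interlace x' y' := by
      simp only [interlace_iff, Finset.mem_range]
      constructor
      · rintro ⟨h, ha⟩
        have key : ∀ i, i < a + 1 → entry v i ≤ entry y i ∧ entry v i ≤ entry y' i ∧
            entry x' i ≤ entry y' i := by
          intro i hi
          rcases Nat.lt_or_ge i a with hl | hl
          · exact ⟨(h i hl).1.2.1, (h i hl).1.2.2.2, (h i hl).2.2⟩
          · obtain rfl : i = a := by omega
            exact ⟨ha.1.1, ha.1.2, ha.2⟩
        exact ⟨⟨⟨fun i hi _ => (key i hi).1, fun i _ hi => (h i (by omega)).1.1⟩,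
          ⟨fun i hi _ => (key i hi).2.1, fun i _ hi => (h i (by omega)).1.2.2.1⟩⟩,
          ⟨fun i hi _ => (key i hi).2.2, fun i _ hi => (h i (by omega)).2.1⟩⟩
      · rintro ⟨⟨h1, h2⟩, h3⟩
        refine ⟨fun i hi => ?_, ⟨h1.1 a (by omega) (by omega), h2.1 a (by omega) (by omega)⟩,
          h3.1 a (by omega) (by omega)⟩
        exact ⟨⟨h1.2 i (by omega) (by omega), h1.1 i (by omega) (by omega),
          h2.2 i (by omega) (by omega), h2.1 i (by omega) (by omega)⟩,
          h3.2 i (by omega) (by omega), h3.1 i (by omega) (by omega)⟩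
    by_cases h : (Interlace v y ∧ Interlace v y') ∧ Interlace x' y'
    · rw [if_pos (iff.2 h).1, if_pos (iff.2 h).2, if_pos h.1, if_pos h.2,
        if_neg (by omega : ¬ (a + 1 < a + 1))]
      have := prod_range_shift a (fun i => q ^ entry y i) (fun i => q ^ entry y' i)
        (fun i => ((q ^ entry v i) ^ 2)⁻¹)
      rw [← mul_assoc (_ * _) (q ^ entry y 0), mul_assoc _ (∏ i ∈ Finset.range a, _), this,
        Finset.prod_range_succ]
      ring
    · have hr : ∀ p p' : Prop, ¬ (p ∧ p') → ∀ (_ : Decidable p) (_ : Decidable p') (r r' : ℝ),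
          (if p then r else 0) * (if p' then r' else 0) = 0 := by
        intro p p' hp _ _ r r'
        split_ifs <;> simp_all
      rw [hr _ _ h, mul_comm (ite _ _ _) (ite _ _ _), hr _ _ (fun h' => h (iff.1 h'))]
      simp

end chain

/-- `∏_{m < j} (z - (m + 1/2)²)`. -/
noncomputable def halfProd (j : ℕ) (z : ℝ) : ℝ := ∏ m ∈ Finset.range j, (z - ((m : ℝ) + 1 / 2) ^ 2)

/-- `∏_{m < j} (z - (m + 1)²)`. -/
noncomputable def wholeProd (j : ℕ) (z : ℝ) : ℝ := ∏ m ∈ Finset.range j, (z - ((m : ℝ) + 1) ^ 2)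

theorem halfProd_succ (j : ℕ) (z : ℝ) :
    halfProd (j + 1) z = halfProd j z * (z - ((j : ℝ) + 1 / 2) ^ 2) := Finset.prod_range_succ _ _

theorem wholeProd_succ (j : ℕ) (z : ℝ) :
    wholeProd (j + 1) z = wholeProd j z * (z - ((j : ℝ) + 1) ^ 2) := Finset.prod_range_succ _ _

theorem mul_wholeProd_sq (j : ℕ) (L : ℝ) :
    L * wholeProd j (L ^ 2) = halfProd j ((L - 1 / 2) ^ 2) * (L + j) := by
  induction j with
  | zero => simp [wholeProd, halfProd]
  | succ j ih =>
    rw [wholeProd_succ, halfProd_succ]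
    push_cast
    linear_combination (L ^ 2 - (j + 1) ^ 2) * ih

theorem halfProd_sq (j : ℕ) (L : ℝ) :
    halfProd (j + 1) (L ^ 2) = (L - 1 / 2) * wholeProd j ((L - 1 / 2) ^ 2) * (L + j + 1 / 2) := by
  induction j with
  | zero => simp [wholeProd, halfProd]; ring
  | succ j ih =>
    rw [wholeProd_succ, halfProd_succ (j + 1)]
    push_cast
    linear_combination (L ^ 2 - (j + 1 + 1 / 2) ^ 2) * ih

theorem wholeProd_sub (j : ℕ) (l : ℝ) :
    (l + 1 / 2) * wholeProd j ((l + 1 / 2) ^ 2) - (l - 1 / 2) * wholeProd j ((l - 1 / 2) ^ 2) =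
      (2 * j + 1) * halfProd j (l ^ 2) := by
  have h1 := mul_wholeProd_sq j (l + 1 / 2)
  have h2 := mul_wholeProd_sq j (1 / 2 - l)
  rw [show l + 1 / 2 - 1 / 2 = l by ring] at h1
  rw [show (1 / 2 - l - 1 / 2) ^ 2 = l ^ 2 by ring, show (1 / 2 - l) ^ 2 = (l - 1 / 2) ^ 2 by ring]
    at h2
  linear_combination h1 + h2

theorem halfProd_sub (j : ℕ) (l : ℝ) :
    halfProd (j + 1) ((l + 1 / 2) ^ 2) - halfProd (j + 1) ((l - 1 / 2) ^ 2) =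
      (2 * j + 2) * (l * wholeProd j (l ^ 2)) := by
  have h1 := halfProd_sq j (l + 1 / 2)
  have h2 := halfProd_sq j (1 / 2 - l)
  rw [show l + 1 / 2 - 1 / 2 = l by ring] at h1
  rw [show (1 / 2 - l - 1 / 2) ^ 2 = l ^ 2 by ring, show (1 / 2 - l) ^ 2 = (l - 1 / 2) ^ 2 by ring]
    at h2
  linear_combination h1 - h2

theorem sum_Icc_telescope (P p : ℝ → ℝ) (κ : ℝ) (hP : ∀ l, P (l + 1 / 2) - P (l - 1 / 2) = κ * p l)
    (d : ℝ) {lo hi : ℕ} (h : lo ≤ hi) :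
    κ * ∑ t ∈ Finset.Icc lo hi, p (t + d) = P (hi + d + 1 / 2) - P (lo + d - 1 / 2) := by
  have := Finset.sum_Ico_sub (fun t : ℕ => P (t + d - 1 / 2)) (by omega : lo ≤ hi + 1)
  rw [Finset.mul_sum, ← Finset.Ico_add_one_right_eq_Icc]
  push_cast at this
  rw [show (hi : ℝ) + d + 1 / 2 = hi + 1 + d - 1 / 2 by ring, ← this]
  refine Finset.sum_congr rfl fun t _ => ?_
  rw [← hP]
  ring_nf

theorem det_prod_sub (n : ℕ) (a : ℕ → ℝ) (z : Fin n → ℝ) :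
    (Matrix.of fun i j : Fin n => ∏ m ∈ Finset.range j, (z i - a m)).det =
      (Matrix.vandermonde z).det := by
  rw [Matrix.det_eval_matrixOfPolynomials_eq_det_vandermonde z
    (fun j => ∏ m ∈ Finset.range j, (Polynomial.X - Polynomial.C (a m)))
    (fun j => by rw [Polynomial.natDegree_finsetProd_X_sub_C_eq_card, Finset.card_range])
    (fun j => Polynomial.monic_prod_X_sub_C _ _)]
  simp [Polynomial.eval_prod]

theorem sum_det (n : ℕ) (A : Fin n → Finset ℕ) (g : Fin n → ℕ → Fin n → ℝ) :
    ∑ x ∈ Fintype.piFinset A, (Matrix.of fun i j => g i (x i) j).det =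
      (Matrix.of fun i j => ∑ t ∈ A i, g i t j).det := by
  have := (Matrix.detRowAlternating (n := Fin n) (R := ℝ)).toMultilinearMap.map_sum_finset g A
  refine this.symm.trans ?_
  show Matrix.det _ = Matrix.det _
  congr 1
  ext i j
  simp

theorem det_sub_of_column_one (n : ℕ) (M : Matrix (Fin (n + 1)) (Fin (n + 1)) ℝ)
    (hM : ∀ i, M i 0 = 1) :
    (Matrix.of fun i j : Fin n => M i.castSucc j.succ - M i.succ j.succ).det =
      (-1) ^ n * M.det := by
  set B : Matrix (Fin (n + 1)) (Fin (n + 1)) ℝ :=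
    Matrix.of fun i j => Fin.cases (M 0 j) (fun i' => M i'.succ j - M i'.castSucc j) i with hB
  have h : M.det = B.det := by
    refine Matrix.det_eq_of_forall_row_eq_smul_add_pred (fun _ => 1) (fun j => ?_) (fun i j => ?_)
    · simp [hB]
    · simp [hB]
  have h2 : B.det = (Matrix.of fun i j : Fin n => M i.succ j.succ - M i.castSucc j.succ).det := by
    rw [Matrix.det_succ_column_zero, Fin.sum_univ_succ]
    have h0 : ∀ i : Fin n, B i.succ 0 = 0 := fun i => by simp [hB, hM]
    have h00 : B 0 0 = 1 := by simp [hB, hM]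
    simp only [h0, h00]
    simp only [Fin.val_zero, pow_zero, mul_one, one_mul, mul_zero, zero_mul, Finset.sum_const_zero,
      add_zero]
    congr 1
  rw [h, h2]
  have h3 := Matrix.det_neg (Matrix.of fun i j : Fin n => M i.succ j.succ - M i.castSucc j.succ)
  rw [Fintype.card_fin] at h3
  rw [← h3]
  congr 1
  ext i j
  simp

theorem sum_interlace (N : ℕ) {n c : ℕ} (hc : c = n ∨ c = n + 1) (y : Pos c)
    (hN : ∀ i, entry y i < N) (f : Pos n → ℝ) :
    ∑ x ∈ Fintype.piFinset (fun _ : Fin n => Finset.range N), (if Interlace x y then f x else 0) =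
      ∑ x ∈ Fintype.piFinset (fun i : Fin n => Finset.Icc (entry y (i + 1)) (entry y i)), f x := by
  rw [← Finset.sum_filter]
  congr 1
  ext x
  simp only [Finset.mem_filter, Fintype.mem_piFinset, Finset.mem_range, Finset.mem_Icc,
    interlace_iff]
  constructor
  · rintro ⟨-, h1, h2⟩ i
    have := h1 i i.2 (by omega)
    rw [entry_val] at this
    refine ⟨?_, this⟩
    by_cases h : (i : ℕ) + 1 < c
    · simpa using h2 i i.2 h
    · rw [entry, dif_neg h]
      exact Nat.zero_le _
  · intro h
    refine ⟨fun i => (h i).2.trans_lt (hN _), fun i hi _ => ?_, fun i hi _ => ?_⟩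
    · rw [entry_of_lt x hi]; exact (h ⟨i, hi⟩).2
    · rw [entry_of_lt x hi]; exact (h ⟨i, hi⟩).1

theorem entry_succ_le {c : ℕ} {y : Pos c} (hy : Antitone y) (i : ℕ) :
    entry y (i + 1) ≤ entry y i := by
  by_cases h : i + 1 < c
  · rw [entry_of_lt y h, entry_of_lt y (by omega : i < c)]
    exact hy (by simp)
  · rw [entry, dif_neg h]
    exact Nat.zero_le _

/-- The shifted coordinates, with the parity of the level given as a proposition. -/
noncomputable def shiftedCoord (ev : Prop) [Decidable ev] {b : ℕ} (x : Pos b) (i : Fin b) : ℝ :=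
  (x i : ℝ) + ((b : ℝ) - ((i : ℕ) + 1 : ℝ)) + 1 - (if ev then 0 else 1 / 2)

/-- The numerator of `sFun`, up to sign. -/
noncomputable def weylProd (ev : Prop) [Decidable ev] {b : ℕ} (x : Pos b) : ℝ :=
  (Matrix.vandermonde fun i => shiftedCoord ev x i ^ 2).det *
    (if ev then ∏ i, shiftedCoord ev x i else 1)

theorem shiftedCoord_pos (ev : Prop) [Decidable ev] {b : ℕ} (x : Pos b) (i : Fin b) :
    0 < shiftedCoord ev x i := by
  have h1 : ((i : ℕ) : ℝ) + 1 ≤ b := by exact_mod_cast i.2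
  have h2 : (0 : ℝ) ≤ x i := Nat.cast_nonneg _
  unfold shiftedCoord
  split_ifs <;> linarith

theorem shiftedCoord_lt (ev : Prop) [Decidable ev] {b : ℕ} {x : Pos b} (hx : Antitone x)
    {i j : Fin b} (h : i < j) : shiftedCoord ev x j < shiftedCoord ev x i := by
  have h1 : ((i : ℕ) : ℝ) + 1 ≤ (j : ℕ) := by exact_mod_cast h
  have h2 : (x j : ℝ) ≤ x i := by exact_mod_cast hx h.le
  unfold shiftedCoord
  linarith

theorem sFun_eq (k : ℕ) (x : Pos ((k + 1) / 2)) :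
    sFun k x = weylProd (Even k) x / weylProd (Even k) (0 : Pos ((k + 1) / 2)) := by
  have hs : ∀ x : Pos ((k + 1) / 2), shifted k x = shiftedCoord (Even k) x := fun x => rfl
  rw [sFun, weylProd, weylProd, Matrix.det_vandermonde, Matrix.det_vandermonde, mul_div_mul_comm,
    ← Finset.prod_div_distrib]
  simp_rw [← Finset.prod_div_distrib, hs]
  congr 1
  · refine Finset.prod_congr rfl fun i _ => Finset.prod_congr rfl fun j _ => ?_
    rw [← neg_sub, ← neg_sub (shiftedCoord _ 0 j ^ 2), neg_div_neg_eq]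
  · split_ifs
    · rw [Finset.prod_div_distrib]
    · simp

theorem weylProd_div_pos (ev : Prop) [Decidable ev] {b : ℕ} {x : Pos b} (hx : Antitone x) :
    0 < weylProd ev x / weylProd ev (0 : Pos b) := by
  have key : ∀ {x : Pos b}, Antitone x → ∀ i, ∀ j ∈ Finset.Ioi i,
      shiftedCoord ev x j ^ 2 - shiftedCoord ev x i ^ 2 < 0 := by
    intro x hx i j hj
    have h1 := shiftedCoord_lt ev hx (Finset.mem_Ioi.1 hj)
    have h2 := shiftedCoord_pos ev x j
    nlinarith
  have h0 : Antitone (0 : Pos b) := fun _ _ _ => le_rfl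
  rw [weylProd, weylProd, Matrix.det_vandermonde, Matrix.det_vandermonde, mul_div_mul_comm,
    ← Finset.prod_div_distrib]
  refine mul_pos (Finset.prod_pos fun i _ => ?_) ?_
  · rw [← Finset.prod_div_distrib]
    exact Finset.prod_pos fun j hj => div_pos_of_neg_of_neg (key hx i j hj) (key h0 i j hj)
  · split_ifs
    · exact div_pos (Finset.prod_pos fun i _ => shiftedCoord_pos _ _ _)
        (Finset.prod_pos fun i _ => shiftedCoord_pos _ _ _)
    · simp

theorem sFun_pos (k : ℕ) {x : Pos ((k + 1) / 2)} (hx : Antitone x) : 0 < sFun k x := by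
  rw [sFun_eq]
  exact weylProd_div_pos _ hx

theorem sum_weylProd_even (n : ℕ) : ∃ C : ℝ, ∀ (y : Pos (n + 1)), Antitone y →
    ∑ x ∈ Fintype.piFinset (fun i : Fin n => Finset.Icc (entry y (i + 1)) (entry y i)),
      weylProd True x = C * weylProd False y := by
  refine ⟨(∏ j : Fin n, (2 * (j : ℝ) + 2)⁻¹) * (-1) ^ n, fun y hy => ?_⟩
  have hx : ∀ x : Pos n, weylProd True x =
      (Matrix.of fun i j : Fin n => ((x i : ℝ) + (n - (i : ℕ))) *
        wholeProd j (((x i : ℝ) + (n - (i : ℕ))) ^ 2)).det := by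
    intro x
    have := Matrix.det_mul_column (fun i => (x i : ℝ) + (n - (i : ℕ)))
      (Matrix.of fun i j : Fin n => wholeProd j (((x i : ℝ) + (n - (i : ℕ))) ^ 2))
    simp only [Matrix.of_apply] at this
    rw [this]
    unfold wholeProd
    rw [det_prod_sub n (fun m => ((m : ℝ) + 1) ^ 2), weylProd, if_pos trivial, mul_comm]
    have hs : ∀ i, shiftedCoord True x i = (x i : ℝ) + (n - (i : ℕ)) := by
      intro i; rw [shiftedCoord, if_pos trivial]; ring
    simp_rw [hs]
  simp_rw [hx]
  rw [sum_det n _ (fun i t j => ((t : ℝ) + (n - (i : ℕ))) *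
        wholeProd j (((t : ℝ) + (n - (i : ℕ))) ^ 2))]
  have hsum : ∀ i j : Fin n, ∑ t ∈ Finset.Icc (entry y (i + 1)) (entry y i),
      ((t : ℝ) + (n - (i : ℕ))) * wholeProd j (((t : ℝ) + (n - (i : ℕ))) ^ 2) =
      (2 * (j : ℝ) + 2)⁻¹ * (halfProd (j + 1) (shiftedCoord False y i.castSucc ^ 2) -
        halfProd (j + 1) (shiftedCoord False y i.succ ^ 2)) := by
    intro i j
    have hne : (2 * ((j : ℕ) : ℝ) + 2) ≠ 0 := by positivity
    rw [eq_inv_mul_iff_mul_eq₀ hne]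
    have := sum_Icc_telescope (fun l => halfProd (j + 1) (l ^ 2))
      (fun l => l * wholeProd j (l ^ 2)) (2 * (j : ℝ) + 2) (fun l => halfProd_sub j l)
      (n - (i : ℕ)) (entry_succ_le hy i)
    rw [this]
    simp only [shiftedCoord, if_false]
    rw [show entry y i = y i.castSucc from entry_val y i.castSucc,
      show entry y ((i : ℕ) + 1) = y i.succ from entry_val y i.succ]
    simp only [Fin.val_castSucc, Fin.val_succ]
    push_cast
    congr 3 <;> ring
  simp_rw [hsum]
  have h1 := Matrix.det_mul_row (fun j : Fin n => (2 * (j : ℝ) + 2)⁻¹)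
    (Matrix.of fun i j : Fin n => (halfProd (j + 1) (shiftedCoord False y i.castSucc ^ 2) -
        halfProd (j + 1) (shiftedCoord False y i.succ ^ 2)))
  simp only [Matrix.of_apply] at h1
  have h2 := det_sub_of_column_one n (Matrix.of fun i j : Fin (n + 1) =>
    halfProd j (shiftedCoord False y i ^ 2)) (fun i => by simp [halfProd])
  simp only [Matrix.of_apply, Fin.val_succ] at h2
  rw [h1, h2, weylProd, if_neg not_false]
  unfold halfProd
  rw [det_prod_sub (n + 1) (fun m => ((m : ℝ) + 1 / 2) ^ 2)]
  ring

theorem sum_weylProd_odd (n : ℕ) : ∃ C : ℝ, ∀ (y : Pos n), Antitone y →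
    ∑ x ∈ Fintype.piFinset (fun i : Fin n => Finset.Icc (entry y (i + 1)) (entry y i)),
      weylProd False x = C * weylProd True y := by
  refine ⟨(∏ j : Fin n, (2 * (j : ℝ) + 1)⁻¹) * ((-1) ^ n * (-1) ^ n), fun y hy => ?_⟩
  have hx : ∀ x : Pos n, weylProd False x =
      (Matrix.of fun i j : Fin n => halfProd j (((x i : ℝ) + (n - (i : ℕ) - 1 / 2)) ^ 2)).det := by
    intro x
    unfold halfProd
    rw [det_prod_sub n (fun m => ((m : ℝ) + 1 / 2) ^ 2), weylProd, if_neg not_false, mul_one]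
    have hs : ∀ i, shiftedCoord False x i = (x i : ℝ) + (n - (i : ℕ) - 1 / 2) := by
      intro i; rw [shiftedCoord, if_neg not_false]; ring
    simp_rw [hs]
  simp_rw [hx]
  rw [sum_det n _ (fun i t j => halfProd j (((t : ℝ) + (n - (i : ℕ) - 1 / 2)) ^ 2))]
  set w : ℕ → ℝ := fun i => (entry y i : ℝ) + (n - i) with hw
  have hsum : ∀ i j : Fin n, ∑ t ∈ Finset.Icc (entry y (i + 1)) (entry y i),
      halfProd j (((t : ℝ) + (n - (i : ℕ) - 1 / 2)) ^ 2) =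
      (2 * (j : ℝ) + 1)⁻¹ * (w i * wholeProd j (w i ^ 2) -
        w (i + 1) * wholeProd j (w (i + 1) ^ 2)) := by
    intro i j
    have hne : (2 * ((j : ℕ) : ℝ) + 1) ≠ 0 := by positivity
    rw [eq_inv_mul_iff_mul_eq₀ hne]
    have := sum_Icc_telescope (fun l => l * wholeProd j (l ^ 2))
      (fun l => halfProd j (l ^ 2)) (2 * (j : ℝ) + 1) (fun l => wholeProd_sub j l)
      (n - (i : ℕ) - 1 / 2) (entry_succ_le hy i)
    rw [this, show w i = (entry y i : ℝ) + (n - (i : ℕ) - 1 / 2) + 1 / 2 by simp only [hw]; ring,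
      show w (i + 1) = (entry y (i + 1) : ℝ) + (n - (i : ℕ) - 1 / 2) - 1 / 2 by
        simp only [hw]; push_cast; ring]
  simp_rw [hsum]
  have h1 := Matrix.det_mul_row (fun j : Fin n => (2 * (j : ℝ) + 1)⁻¹)
    (Matrix.of fun i j : Fin n => (w i * wholeProd j (w i ^ 2) -
        w (i + 1) * wholeProd j (w (i + 1) ^ 2)))
  simp only [Matrix.of_apply] at h1
  set M : Matrix (Fin (n + 1)) (Fin (n + 1)) ℝ := Matrix.of fun i j : Fin (n + 1) =>
    Fin.cases 1 (fun j : Fin n => w i * wholeProd j (w i ^ 2)) j with hM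
  have h2 := det_sub_of_column_one n M (fun i => by simp [hM])
  simp only [hM, Matrix.of_apply, Fin.val_succ, Fin.cases_succ, Fin.val_castSucc] at h2
  have hwn : w n = 0 := by simp [hw, entry]
  have h3 : M.det = (-1) ^ n * weylProd True y := by
    rw [Matrix.det_succ_row M (Fin.last n), Fin.sum_univ_succ]
    have hz : ∀ j : Fin n, M (Fin.last n) j.succ = 0 := fun j => by simp [hM, hwn]
    have ho : M (Fin.last n) 0 = 1 := by simp [hM]
    simp only [hz, ho, mul_zero, zero_mul, Finset.sum_const_zero, add_zero, Fin.val_last,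
      Fin.val_zero, mul_one]
    congr 1
    have hcol := Matrix.det_mul_column (fun i : Fin n => w i)
      (Matrix.of fun i j : Fin n => wholeProd j (w i ^ 2))
    simp only [Matrix.of_apply] at hcol
    have hsub : M.submatrix (Fin.last n).succAbove (Fin.succAbove 0) =
        Matrix.of fun i j : Fin n => w i * wholeProd j (w i ^ 2) := by
      ext i j
      simp [hM]
    rw [hsub, hcol, weylProd, if_pos trivial, mul_comm]
    have hs : ∀ i : Fin n, shiftedCoord True y i = w i := by
      intro i; rw [shiftedCoord, if_pos trivial]; simp only [hw, entry_val]; ring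
    simp_rw [hs]
    unfold wholeProd
    rw [det_prod_sub n (fun m => ((m : ℝ) + 1) ^ 2)]
  rw [← hM, h3] at h2
  rw [h1, h2]
  ring

/-- The branching rule. -/
theorem sum_sFun (k N : ℕ) (y : Pos ((k + 1 + 1) / 2)) (hy : Antitone y)
    (hN : ∀ i, entry y i < N) :
    ∑ x ∈ Fintype.piFinset (fun _ : Fin ((k + 1) / 2) => Finset.range N),
      (if Interlace x y then sFun k x else 0) = sFun (k + 1) y := by
  have aux : ∀ (ev ev' : Prop) [Decidable ev] [Decidable ev'] (b c : ℕ),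
      (ev ∧ ¬ ev' ∧ c = b + 1) ∨ (¬ ev ∧ ev' ∧ c = b) → ∃ C : ℝ, ∀ (y : Pos c), Antitone y →
      ∑ x ∈ Fintype.piFinset (fun i : Fin b => Finset.Icc (entry y (i + 1)) (entry y i)),
        weylProd ev x = C * weylProd ev' y := by
    rintro ev ev' _ _ b c (⟨h, h', rfl⟩ | ⟨h, h', rfl⟩)
    · obtain ⟨C, hC⟩ := sum_weylProd_even b
      refine ⟨C, fun y hy => ?_⟩
      have := hC y hy
      simp only [weylProd, shiftedCoord, if_pos h, if_neg h', if_true, if_false] at this ⊢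
      exact this
    · obtain ⟨C, hC⟩ := sum_weylProd_odd c
      refine ⟨C, fun y hy => ?_⟩
      have := hC y hy
      simp only [weylProd, shiftedCoord, if_neg h, if_pos h', if_true, if_false] at this ⊢
      exact this
  have hpar : (Even k ∧ ¬ Even (k + 1) ∧ (k + 1 + 1) / 2 = (k + 1) / 2 + 1) ∨
      (¬ Even k ∧ Even (k + 1) ∧ (k + 1 + 1) / 2 = (k + 1) / 2) := by
    simp only [Nat.even_iff]; omega
  obtain ⟨C, hC⟩ := aux (Even k) (Even (k + 1)) _ _ hpar
  have h0 : Antitone (0 : Pos ((k + 1 + 1) / 2)) := fun _ _ _ => le_rfl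
  have hC0 := hC 0 h0
  have e0 : ∀ i, entry (0 : Pos ((k + 1 + 1) / 2)) i = 0 := by
    intro i; unfold entry; split_ifs <;> rfl
  simp only [e0] at hC0
  rw [show Fintype.piFinset (fun _ : Fin ((k + 1) / 2) => Finset.Icc 0 0) = {0} by
    ext x; simp [funext_iff], Finset.sum_singleton] at hC0
  have n1 : weylProd (Even k) (0 : Pos ((k + 1) / 2)) ≠ 0 := by
    have := weylProd_div_pos (Even k) (x := (0 : Pos ((k + 1) / 2))) (fun _ _ _ => le_rfl)
    intro h; simp [h] at this
  have n2 : weylProd (Even (k + 1)) (0 : Pos ((k + 1 + 1) / 2)) ≠ 0 := by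
    have := weylProd_div_pos (Even (k + 1)) h0
    intro h; simp [h] at this
  rw [sum_interlace N (by omega) y hN]
  simp_rw [sFun_eq]
  rw [← Finset.sum_div, hC y hy, hC0]
  rw [hC0] at n1
  have n3 := left_ne_zero_of_mul n1
  field_simp

section independence
variable {Ω : Type*} [MeasurableSpace Ω] {μ : Measure Ω}

theorem hasSum_measureReal_inter [IsFiniteMeasure μ] {β : Type*} [Countable β] [MeasurableSpace β]
    [MeasurableSingletonClass β] {Y : Ω → β} (hY : Measurable Y) {A : Set Ω}
    (hA : MeasurableSet A) :
    HasSum (fun b => μ.real {ω | ω ∈ A ∧ Y ω = b}) (μ.real A) := by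
  have hU : A = ⋃ b, {ω | ω ∈ A ∧ Y ω = b} := by
    ext ω; simp
  have hm : ∀ b, MeasurableSet {ω | ω ∈ A ∧ Y ω = b} := fun b =>
    hA.inter (hY (measurableSet_singleton b))
  have hd : Pairwise (Function.onFun Disjoint fun b => {ω | ω ∈ A ∧ Y ω = b}) := by
    intro b b' hb
    refine Set.disjoint_left.2 fun ω h h' => hb (h.2.symm.trans h'.2)
  have hμ := measure_iUnion (μ := μ) hd hm
  rw [← hU] at hμ
  have : ∑' b, μ {ω | ω ∈ A ∧ Y ω = b} ≠ ⊤ := by rw [← hμ]; exact measure_ne_top _ _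
  have h := ENNReal.hasSum_toReal this
  rw [← ENNReal.tsum_toReal_eq fun b => measure_ne_top _ _, ← hμ] at h
  exact h

/-- Events that depend on disjoint sets of independent variables have product probability. -/
theorem measureReal_inter_biInter {ι κ : Type*} {m : ι → MeasurableSpace Ω}
    (hm : ∀ i, m i ≤ ‹MeasurableSpace Ω›) (hi : iIndep m μ) (S₀ : Set ι) (S : κ → Set ι)
    (hS₀ : ∀ a, Disjoint S₀ (S a)) (hS : Pairwise (Function.onFun Disjoint S))
    (E₀ : Set Ω) (E : κ → Set Ω) (T : Finset κ) (hE₀ : MeasurableSet[⨆ i ∈ S₀, m i] E₀)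
    (hE : ∀ a ∈ T, MeasurableSet[⨆ i ∈ S a, m i] (E a)) :
    μ.real (E₀ ∩ ⋂ a ∈ T, E a) = μ.real E₀ * ∏ a ∈ T, μ.real (E a) := by
  classical
  have hmono : ∀ {A B : Set ι}, A ⊆ B → (⨆ i ∈ A, m i) ≤ ⨆ i ∈ B, m i := fun h =>
    biSup_mono h
  have hmeas : ∀ T : Finset κ, (∀ a ∈ T, MeasurableSet[⨆ i ∈ S a, m i] (E a)) →
      MeasurableSet[⨆ i ∈ S₀ ∪ ⋃ a ∈ T, S a, m i] (E₀ ∩ ⋂ a ∈ T, E a) := by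
    intro T hE
    refine MeasurableSet.inter (hmono Set.subset_union_left _ hE₀) ?_
    refine Finset.measurableSet_biInter T fun a ha => hmono ?_ _ (hE a ha)
    exact (Set.subset_biUnion_of_mem (u := S) ha).trans Set.subset_union_right
  induction T using Finset.induction_on with
  | empty => simp
  | insert a T ha ih =>
    have hT := fun b hb => hE b (Finset.mem_insert_of_mem hb)
    rw [Finset.prod_insert ha, mul_left_comm, ← ih hT, Finset.set_biInter_insert, mul_comm,
      Set.inter_comm (E a), ← Set.inter_assoc]
    have hdis : Disjoint (S₀ ∪ ⋃ a ∈ T, S a) (S a) := by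
      rw [Set.disjoint_union_left]
      refine ⟨hS₀ a, ?_⟩
      simp only [Set.disjoint_iUnion_left]
      intro b hb
      exact hS fun h => ha (h ▸ hb)
    have := (Indep_iff _ _ μ).1 (indep_iSup_of_disjoint hm hi hdis) _ _ (hmeas T hT)
      (hE a (Finset.mem_insert_self a T))
    simp only [measureReal_def, this, ENNReal.toReal_mul]

end independence

section geometric
variable {Ω : Type*} [MeasurableSpace Ω] {μ : Measure Ω} [IsProbabilityMeasure μ] {q : ℝ}

theorem measureReal_ge_of_geometric {e : Ω → ℕ} (he : Measurable e)
    (hg : ∀ x, μ.real {ω | e ω = x} = (1 - q) * q ^ x) (d : ℕ) :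
    μ.real {ω | d ≤ e ω} = q ^ d := by
  induction d with
  | zero => simp
  | succ d ih =>
    have hU : {ω | d ≤ e ω} = {ω | e ω = d} ∪ {ω | d + 1 ≤ e ω} := by
      ext ω; simp only [Set.mem_ofPred_eq, Set.mem_union]; omega
    have hd : Disjoint {ω | e ω = d} {ω | d + 1 ≤ e ω} :=
      Set.disjoint_left.2 fun ω h h' => by simp only [Set.mem_ofPred_eq] at h h'; omega
    rw [hU, measureReal_union hd (he (measurableSet_Ici (a := d + 1))), hg] at ih
    rw [pow_succ]
    linarith

theorem measureReal_leftJump {e : Ω → ℕ} (he : Measurable e)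
    (hg : ∀ x, μ.real {ω | e ω = x} = (1 - q) * q ^ x) {m x : ℕ} (hx : x ≤ m) (v : ℕ) :
    μ.real {ω | v = max x (m - e ω)} = leftLaw q m x v := by
  unfold leftLaw
  split_ifs with h1 h2
  · rw [mul_one, ← measureReal_ge_of_geometric he hg]
    congr 1; ext ω; simp only [Set.mem_ofPred_eq]; omega
  · rw [mul_comm, ← hg]
    congr 1; ext ω; simp only [Set.mem_ofPred_eq]; omega
  · rw [show {ω | v = max x (m - e ω)} = ∅ by ext ω; simp; omega]
    simp

theorem measureReal_rightJump {e : Ω → ℕ} (he : Measurable e)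
    (hg : ∀ x, μ.real {ω | e ω = x} = (1 - q) * q ^ x) {u m : ℕ} (hm : m ≤ u) (y : ℕ) :
    μ.real {ω | y = min u (m + e ω)} = rightLaw q u m y := by
  unfold rightLaw
  split_ifs with h1 h2
  · rw [mul_one, ← measureReal_ge_of_geometric he hg]
    congr 1; ext ω; simp only [Set.mem_ofPred_eq]; omega
  · rw [mul_comm, ← hg]
    congr 1; ext ω; simp only [Set.mem_ofPred_eq]; omega
  · rw [show {ω | y = min u (m + e ω)} = ∅ by ext ω; simp; omega]
    simp

theorem measureReal_leftJump_rightJump {e e' : Ω → ℕ} (he : Measurable e) (he' : Measurable e')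
    (hind : IndepFun e e' μ)
    (hg : ∀ x, μ.real {ω | e ω = x} = (1 - q) * q ^ x)
    (hg' : ∀ x, μ.real {ω | e' ω = x} = (1 - q) * q ^ x) {m x u x' : ℕ} (hx : x ≤ m) (hm : m ≤ u)
    (hx' : x' ≤ u) (v y' : ℕ) :
    μ.real {ω | v = max x (m - e ω) ∧ y' = min u (max v x' + e' ω)} =
      leftLaw q m x v * rightLaw q u (max v x') y' := by
  have h := hind.measure_inter_preimage_eq_mul {n | v = max x (m - n)}
    {n | y' = min u (max v x' + n)} (Set.to_countable _).measurableSet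
    (Set.to_countable _).measurableSet
  have h' : μ.real {ω | v = max x (m - e ω) ∧ y' = min u (max v x' + e' ω)} =
      μ.real {ω | v = max x (m - e ω)} * μ.real {ω | y' = min u (max v x' + e' ω)} := by
    simp only [measureReal_def, ← ENNReal.toReal_mul]
    exact congrArg ENNReal.toReal h
  rw [h', measureReal_leftJump he hg hx]
  by_cases hv : v ≤ m
  · rw [measureReal_rightJump he' hg' (by omega)]
  · rw [leftLaw, if_neg (by omega), zero_mul, zero_mul]

theorem hasSum_indep {e e' : Ω → ℕ} (he : Measurable e) (he' : Measurable e')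
    (hind : IndepFun e e' μ) (B : ℕ → Set ℕ) :
    HasSum (fun j => μ.real {ω | e ω = j} * μ.real {ω | e' ω ∈ B j})
      (μ.real {ω | e' ω ∈ B (e ω)}) := by
  have hA : MeasurableSet {ω | e' ω ∈ B (e ω)} :=
    (he.prodMk he') (Set.to_countable {p : ℕ × ℕ | p.2 ∈ B p.1}).measurableSet
  have h := hasSum_measureReal_inter (μ := μ) he hA
  convert h using 2 with j
  have h2 := hind.measure_inter_preimage_eq_mul {j} (B j) (Set.to_countable _).measurableSet
    (Set.to_countable _).measurableSet
  simp only [measureReal_def, ← ENNReal.toReal_mul]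
  refine congrArg ENNReal.toReal (h2.symm.trans (congrArg μ ?_))
  ext ω
  simp only [Set.mem_inter_iff, Set.mem_preimage, Set.mem_singleton_iff, Set.mem_ofPred_eq]
  constructor
  · rintro ⟨rfl, h⟩; exact ⟨h, rfl⟩
  · rintro ⟨h, rfl⟩; exact ⟨rfl, h⟩

theorem hasSum_geometric_sq (hq0 : 0 < q) (hq1 : q < 1) (r : ℝ) :
    HasSum (fun j : ℕ => (1 - q) * q ^ j * (r * q ^ j)) (r / (1 + q)) := by
  have h := (hasSum_geometric_of_lt_one (sq_nonneg q) (by nlinarith : q ^ 2 < 1)).mul_left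
    ((1 - q) * r)
  have h1 : (1 - q) ≠ 0 := by linarith
  have h2 : (1 + q) ≠ 0 := by linarith
  have e : (1 - q) * r * (1 - q ^ 2)⁻¹ = r / (1 + q) := by
    rw [show 1 - q ^ 2 = (1 - q) * (1 + q) by ring]
    field_simp
  rw [e] at h
  have hf : (fun j : ℕ => (1 - q) * q ^ j * (r * q ^ j)) =
      fun j : ℕ => (1 - q) * r * (q ^ 2) ^ j := by
    ext j
    rw [← pow_mul, mul_comm 2 j, pow_mul]
    ring
  rwa [hf]

theorem measureReal_diff_eq (hq0 : 0 < q) (hq1 : q < 1) {e e' : Ω → ℕ} (he : Measurable e)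
    (he' : Measurable e') (hind : IndepFun e e' μ)
    (hg : ∀ x, μ.real {ω | e ω = x} = (1 - q) * q ^ x)
    (hg' : ∀ x, μ.real {ω | e' ω = x} = (1 - q) * q ^ x) (d : ℕ) :
    μ.real {ω | e' ω = e ω + d} = (1 - q) / (1 + q) * q ^ d := by
  have h := hasSum_indep he he' hind (fun j => {n | n = j + d})
  simp only [Set.mem_ofPred_eq, hg, hg'] at h
  refine h.unique ?_
  have := hasSum_geometric_sq hq0 hq1 ((1 - q) * q ^ d)
  convert this using 1
  · ext j; ring
  · ring

theorem measureReal_diff_ge (hq0 : 0 < q) (hq1 : q < 1) {e e' : Ω → ℕ} (he : Measurable e)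
    (he' : Measurable e') (hind : IndepFun e e' μ)
    (hg : ∀ x, μ.real {ω | e ω = x} = (1 - q) * q ^ x)
    (hg' : ∀ x, μ.real {ω | e' ω = x} = (1 - q) * q ^ x) (d : ℕ) :
    μ.real {ω | e ω + d ≤ e' ω} = q ^ d / (1 + q) := by
  have h := hasSum_indep he he' hind (fun j => {n | j + d ≤ n})
  simp only [Set.mem_ofPred_eq, hg, measureReal_ge_of_geometric he' hg'] at h
  refine h.unique ?_
  have := hasSum_geometric_sq hq0 hq1 (q ^ d)
  convert this using 1
  ext j; ring

theorem measureReal_wallJump (hq0 : 0 < q) (hq1 : q < 1) {e e' : Ω → ℕ} (he : Measurable e)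
    (he' : Measurable e') (hind : IndepFun e e' μ)
    (hg : ∀ x, μ.real {ω | e ω = x} = (1 - q) * q ^ x)
    (hg' : ∀ x, μ.real {ω | e' ω = x} = (1 - q) * q ^ x) (u y y' : ℕ) :
    μ.real {ω | y' = min u (partialReflect (((min u y : ℕ) : ℤ) + (e' ω : ℤ) - (e ω : ℤ)))} =
      wallLaw q u y y' := by
  have hq := hq0.ne'
  have h1 : (1 - q) ≠ 0 := by linarith
  have h2 : (1 + q) ≠ 0 := by linarith
  have meas : ∀ p : ℕ → ℕ → Prop, MeasurableSet {ω | p (e ω) (e' ω)} := fun p =>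
    (he.prodMk he') (Set.to_countable {x : ℕ × ℕ | p x.1 x.2}).measurableSet
  have union : ∀ p p' : ℕ → ℕ → Prop, (∀ a b, p a b → ¬ p' a b) →
      μ.real {ω | p (e ω) (e' ω) ∨ p' (e ω) (e' ω)} =
        μ.real {ω | p (e ω) (e' ω)} + μ.real {ω | p' (e ω) (e' ω)} := fun p p' h =>
    measureReal_union (Set.disjoint_left.2 fun ω => h _ _) (meas p')
  have d1 := measureReal_diff_eq hq0 hq1 he he' hind hg hg'
  have d2 := measureReal_diff_eq hq0 hq1 he' he hind.symm hg' hg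
  have t1 := measureReal_diff_ge hq0 hq1 he he' hind hg hg'
  have t2 := measureReal_diff_ge hq0 hq1 he' he hind.symm hg' hg
  have split : ∀ d : ℤ, partialReflect d = if 0 ≤ d then d.toNat else (-d - 1).toNat :=
    fun d => rfl
  set m := min u y with hm
  rcases lt_trichotomy y' u with h | h | h
  · have hR : μ.real {ω | y' = min u (partialReflect ((m : ℤ) + (e' ω : ℤ) - (e ω : ℤ)))} =
        wallKernel q m y' := by
      rcases le_total m y' with hmy | hmy
      · rw [wallKernel_of_le hmy, mul_add, ← d1, ← d2,
          ← union (fun a b => b = a + (y' - m)) (fun a b => a = b + (m + y' + 1)) (by omega)]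
        congr 1; ext ω; simp only [Set.mem_ofPred_eq, split]; split_ifs <;> omega
      · rw [wallKernel_of_ge hmy, mul_add, ← d2, ← d2,
          ← union (fun a b => a = b + (m - y')) (fun a b => a = b + (m + y' + 1)) (by omega)]
        congr 1; ext ω; simp only [Set.mem_ofPred_eq, split]; split_ifs <;> omega
    rw [hR, wallLaw, capWeight, if_pos h.le, if_neg h.ne]
    rcases le_total u y with huy | huy
    · obtain ⟨d, rfl⟩ := Nat.exists_eq_add_of_le huy
      rw [hm, min_eq_left huy, wallKernel_of_ge h.le, wallKernel_of_ge (by omega),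
        show u + d - y' = u - y' + d by omega]
      field_simp
      ring
    · rw [hm, min_eq_right huy]
      field_simp
  · subst h
    have hT : μ.real {ω | y' = min y' (partialReflect ((m : ℤ) + (e' ω : ℤ) - (e ω : ℤ)))} =
        q ^ (y' - m) / (1 + q) + q ^ (m + y' + 1) / (1 + q) := by
      rw [← t1, ← t2,
        ← union (fun a b => a + (y' - m) ≤ b) (fun a b => b + (m + y' + 1) ≤ a) (by omega)]
      congr 1; ext ω; simp only [Set.mem_ofPred_eq, split]; split_ifs <;> omega
    rw [hT, wallLaw, capWeight, if_pos le_rfl, if_pos rfl]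
    rcases le_total y' y with huy | huy
    · obtain ⟨d, rfl⟩ := Nat.exists_eq_add_of_le huy
      rw [hm, min_eq_left huy, wallKernel_of_ge huy, show y' + d - y' = d by omega,
        show y' - y' = 0 by omega]
      field_simp
      ring
    · rw [hm, min_eq_right huy, wallKernel_of_le huy]
      field_simp
  · rw [show {ω | y' = min u (partialReflect ((m : ℤ) + (e' ω : ℤ) - (e ω : ℤ)))} = ∅ by
      ext ω; simp only [Set.mem_ofPred_eq, Set.mem_empty_iff_false, iff_false]; omega,
      wallLaw, capWeight, if_neg (by omega)]
    simp

end geometric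

/-- The pair `(X^k(n - 1/2), X^k(n))`. -/
def pairAt (ξ : ℕ → ℕ → ℕ → ℕ) (k n : ℕ) : Pos (k / 2) × Pos ((k + 1) / 2) :=
  (halfLevelBefore ξ k n, levelAt ξ k n)

/-- `min (u_{i-1}) z`, with `u_{-1} = ∞`. -/
def capPush (u : ℕ → ℕ) (i z : ℕ) : ℕ := if i = 0 then z else min (u (i - 1)) z

/-- The noise values `e`, `e'` move the particle `i` from `y i` to `v i` and then to `y' i`. -/
def MovesTo (b : ℕ) (x u x' y v y' : ℕ → ℕ) (i e e' : ℕ) : Prop :=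
  (i < b → v i = max (x i) (capPush u i (y i) - e)) ∧
    y' i = capPush u i (if i < b then max (v i) (x' i) + e'
      else partialReflect ((capPush u i (y i) : ℤ) + (e' : ℤ) - (e : ℤ)))

section dynamics
variable (ξ : ℕ → ℕ → ℕ → ℕ)

theorem particles_left (n k i : ℕ) :
    particles ξ (2 * n + 1) (k + 1) (i + 1) =
      if 2 * (i + 1) = (k + 1) + 1 then
        capBy (particles ξ (2 * n + 1) k) (i + 1) (particles ξ (2 * n) (k + 1) (i + 1))
      else max (particles ξ (2 * n) k (i + 1))
        (capBy (particles ξ (2 * n + 1) k) (i + 1) (particles ξ (2 * n) (k + 1) (i + 1)) -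
          ξ (2 * n + 1) (k + 1) (i + 1)) := by
  simp only [particles, even_two_mul, if_true]
  rw [leftStep]

theorem particles_right (n k i : ℕ) :
    particles ξ (2 * n + 2) (k + 1) (i + 1) =
      capBy (particles ξ (2 * n + 1) k) (i + 1) (if 2 * (i + 1) = (k + 1) + 1 then
        partialReflect ((particles ξ (2 * n + 1) (k + 1) (i + 1) : ℤ) +
          (ξ (2 * n + 2) (k + 1) (i + 1) : ℤ) - (ξ (2 * n + 1) (k + 1) (i + 1) : ℤ))
      else max (particles ξ (2 * n + 1) (k + 1) (i + 1)) (particles ξ (2 * n + 2) k (i + 1)) +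
        ξ (2 * n + 2) (k + 1) (i + 1)) := by
  have : ¬ Even (2 * n + 1) := by simp
  have h : particles ξ (2 * n + 2) = rightStep (particles ξ (2 * n + 1)) (ξ (2 * n + 1))
      (ξ (2 * n + 2)) := by
    rw [particles, if_neg this]
  rw [h, rightStep]

theorem entry_levelAt (k n : ℕ) {i : ℕ} (hi : i < (k + 1) / 2) :
    entry (levelAt ξ k n) i = particles ξ (2 * n) k (i + 1) := entry_of_lt _ hi

theorem entry_halfLevelBefore (k n : ℕ) {i : ℕ} (hi : i < k / 2) :
    entry (halfLevelBefore ξ k (n + 1)) i = particles ξ (2 * n + 1) k (i + 1) := entry_of_lt _ hi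

theorem capPush_halfLevelBefore (k n : ℕ) {i : ℕ} (hi : i < (k + 1 + 1) / 2) (z : ℕ) :
    capPush (entry (halfLevelBefore ξ k (n + 1))) i z =
      capBy (particles ξ (2 * n + 1) k) (i + 1) z := by
  cases i with
  | zero => simp [capPush, capBy]
  | succ i =>
    rw [capPush, capBy, if_neg (by omega), if_neg (by omega), Nat.add_sub_cancel,
      entry_halfLevelBefore _ _ _ (by omega), Nat.add_sub_cancel]

theorem eq_iff_entry {n : ℕ} (y y' : Pos n) : y = y' ↔ ∀ i < n, entry y i = entry y' i := by
  constructor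
  · rintro rfl _ _; rfl
  · intro h
    ext i
    simpa using h i i.2

theorem pairAt_succ_iff (k n : ℕ) (p : Pos ((k + 1) / 2) × Pos ((k + 1 + 1) / 2)) :
    pairAt ξ (k + 1) (n + 1) = p ↔ ∀ i < (k + 1 + 1) / 2,
      MovesTo ((k + 1) / 2) (entry (levelAt ξ k n)) (entry (pairAt ξ k (n + 1)).1)
        (entry (pairAt ξ k (n + 1)).2) (entry (levelAt ξ (k + 1) n)) (entry p.1) (entry p.2) i
        (ξ (2 * n + 1) (k + 1) (i + 1)) (ξ (2 * n + 2) (k + 1) (i + 1)) := by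
  have key : ∀ i < (k + 1 + 1) / 2,
      (MovesTo ((k + 1) / 2) (entry (levelAt ξ k n)) (entry (pairAt ξ k (n + 1)).1)
        (entry (pairAt ξ k (n + 1)).2) (entry (levelAt ξ (k + 1) n)) (entry p.1) (entry p.2) i
        (ξ (2 * n + 1) (k + 1) (i + 1)) (ξ (2 * n + 2) (k + 1) (i + 1)) ↔
      (i < (k + 1) / 2 → particles ξ (2 * n + 1) (k + 1) (i + 1) = entry p.1 i) ∧
        particles ξ (2 * n + 2) (k + 1) (i + 1) = entry p.2 i) := by
    intro i hi
    rw [MovesTo, particles_right]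
    simp only [pairAt]
    rw [capPush_halfLevelBefore ξ k n hi, capPush_halfLevelBefore ξ k n hi,
      entry_levelAt ξ (k + 1) n hi]
    by_cases hb : i < (k + 1) / 2
    · have hne : ¬ (2 * (i + 1) = k + 1 + 1) := by omega
      have hl := particles_left ξ n k i
      rw [if_neg hne] at hl
      rw [entry_levelAt ξ k n hb, entry_levelAt ξ k (n + 1) hb, if_neg hne, if_pos hb, ← hl]
      simp only [hb, forall_true_left]
      constructor
      · rintro ⟨h1, h2⟩; exact ⟨h1.symm, by rw [h2, h1]; rfl⟩
      · rintro ⟨h1, h2⟩; exact ⟨h1.symm, by rw [← h2, h1]; rfl⟩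
    · have he : 2 * (i + 1) = k + 1 + 1 := by omega
      have hl := particles_left ξ n k i
      rw [if_pos he] at hl
      rw [if_pos he, if_neg hb, ← hl]
      simp only [hb, false_imp_iff, true_and]
      exact eq_comm
  rw [Prod.ext_iff, eq_iff_entry, eq_iff_entry]
  simp only [pairAt]
  constructor
  · rintro ⟨h1, h2⟩ i hi
    refine (key i hi).2 ⟨fun hb => ?_, ?_⟩
    · rw [← h1 i hb, entry_halfLevelBefore ξ (k + 1) n hb]
    · rw [← h2 i hi, entry_levelAt ξ (k + 1) (n + 1) hi]; rfl
  · intro h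
    refine ⟨fun i hb => ?_, fun i hi => ?_⟩
    · rw [← ((key i (by omega)).1 (h i (by omega))).1 hb,
        entry_halfLevelBefore ξ (k + 1) n hb]
    · rw [← ((key i hi).1 (h i hi)).2, entry_levelAt ξ (k + 1) (n + 1) hi]; rfl

theorem pairAt_zero (k : ℕ) : pairAt ξ k 0 = 0 := rfl

end dynamics

section measurability
variable {Ω : Type*} [MeasurableSpace Ω] {ξ : Ω → ℕ → ℕ → ℕ → ℕ}

theorem measurable_capBy {b : Ω → ℕ → ℕ} {x : Ω → ℕ} {i : ℕ}
    (hb : i ≠ 1 → Measurable fun ω => b ω (i - 1)) (hx : Measurable x) :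
    Measurable fun ω => capBy (b ω) i (x ω) := by
  by_cases h : i = 1
  · simpa only [capBy, if_pos h]
  · simp only [capBy, if_neg h]
    exact (hb h).min hx

theorem measurable_particles (t k : ℕ)
    (hξ : ∀ t' ≤ t, ∀ k' ≤ k, ∀ i, 1 ≤ i → i ≤ (k' + 1) / 2 → Measurable fun ω => ξ ω t' k' i)
    (i : ℕ) (hi : 1 ≤ i) (hi' : i ≤ (k + 1) / 2) : Measurable fun ω => particles (ξ ω) t k i := by
  induction t generalizing k i with
  | zero => exact measurable_const
  | succ t iht =>
    have hprev : ∀ k' ≤ k, ∀ i, 1 ≤ i → i ≤ (k' + 1) / 2 →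
        Measurable fun ω => particles (ξ ω) t k' i := fun k' hk' i hi hi' =>
      iht k' (fun t' ht' j hj => hξ t' (by omega) j (by omega)) i hi hi'
    clear iht
    by_cases ht : Even t
    · simp only [particles, if_pos ht]
      induction k generalizing i with
      | zero => omega
      | succ k ihk =>
        have ih := fun i hi hi' => ihk (fun t' ht' j hj => hξ t' ht' j (by omega)) i hi hi'
          (fun k' hk' => hprev k' (by omega))
        have hcap : Measurable fun ω => capBy (leftStep (particles (ξ ω) t) (ξ ω (t + 1)) k) i
            (particles (ξ ω) t (k + 1) i) :=
          measurable_capBy (b := fun ω => leftStep (particles (ξ ω) t) (ξ ω (t + 1)) k)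
            (fun h => ih (i - 1) (by omega) (by omega)) (hprev _ le_rfl i hi hi')
        simp only [leftStep]
        split_ifs with h
        · exact hcap
        · exact (hprev k (by omega) i hi (by omega)).max
            (hcap.sub (hξ _ le_rfl _ le_rfl i hi hi'))
    · simp only [particles, if_neg ht]
      induction k generalizing i with
      | zero => omega
      | succ k ihk =>
        have ih := fun i hi hi' => ihk (fun t' ht' j hj => hξ t' ht' j (by omega)) i hi hi'
          (fun k' hk' => hprev k' (by omega))
        simp only [rightStep]
        refine measurable_capBy (b := fun ω => particles (ξ ω) t k)
          (fun h => hprev k (by omega) (i - 1) (by omega) (by omega)) ?_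
        split_ifs with h
        · exact (measurable_of_countable fun p : ℕ × ℕ × ℕ =>
            partialReflect ((p.1 : ℤ) + (p.2.1 : ℤ) - (p.2.2 : ℤ))).comp
            ((hprev _ le_rfl i hi hi').prodMk ((hξ _ le_rfl _ le_rfl i hi hi').prodMk
              (hξ t (by omega) _ le_rfl i hi hi')))
        · exact ((hprev _ le_rfl i hi hi').max (ih i hi (by omega))).add
            (hξ _ le_rfl _ le_rfl i hi hi')

theorem measurable_pairAt (n k : ℕ)
    (hξ : ∀ t' ≤ 2 * n, ∀ k' ≤ k, ∀ i, 1 ≤ i → i ≤ (k' + 1) / 2 →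
      Measurable fun ω => ξ ω t' k' i) :
    Measurable fun ω => pairAt (ξ ω) k n := by
  refine Measurable.prodMk ?_ ?_
  · cases n with
    | zero => exact measurable_const
    | succ n =>
      refine measurable_pi_lambda _ fun i => ?_
      exact measurable_particles _ k (fun t' ht' => hξ t' (by omega)) _ (by omega) (by omega)
  · refine measurable_pi_lambda _ fun i => ?_
    exact measurable_particles _ k (fun t' ht' => hξ t' (by omega)) _ (by omega) (by omega)

end measurability

/-- The noise variables are measurable, independent and geometric. -/
structure IsGeometricNoise {Ω : Type*} [MeasurableSpace Ω] (q : ℝ) (μ : Measure Ω)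
    (ξ : Ω → ℕ → ℕ → ℕ → ℕ) : Prop where
  meas : ∀ p : NoiseIndex, Measurable (fun ω => ξ ω p.1.1 p.1.2.1 p.1.2.2)
  indep : iIndepFun (fun (p : NoiseIndex) (ω : Ω) => ξ ω p.1.1 p.1.2.1 p.1.2.2) μ
  geom : ∀ (p : NoiseIndex) (x : ℕ),
      μ.real {ω | ξ ω p.1.1 p.1.2.1 p.1.2.2 = x} = (1 - q) * q ^ x

/-- The particle `i + 1` of level `k + 1` makes a given move between the times `m` and `m + 1`. -/
def moveEvent {Ω : Type*} (ξ : Ω → ℕ → ℕ → ℕ → ℕ) (k m : ℕ) (x u x' y v y' : ℕ → ℕ) (i : ℕ) :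
    Set Ω :=
  {ω | MovesTo ((k + 1) / 2) x u x' y v y' i (ξ ω (2 * m + 1) (k + 1) (i + 1))
    (ξ ω (2 * m + 2) (k + 1) (i + 1))}

/-- The probability that the noise moves level `k + 1` in a given way between the times `m` and
`m + 1`. -/
noncomputable def moveProb {Ω : Type*} [MeasurableSpace Ω] (μ : Measure Ω)
    (ξ : Ω → ℕ → ℕ → ℕ → ℕ) (k m : ℕ) (x : Pos ((k + 1) / 2))
    (b : Pos (k / 2) × Pos ((k + 1) / 2)) (y : Pos ((k + 1 + 1) / 2))
    (p : Pos ((k + 1) / 2) × Pos ((k + 1 + 1) / 2)) : ℝ :=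
  ∏ i ∈ Finset.range ((k + 1 + 1) / 2), μ.real (moveEvent ξ k m (entry x) (entry b.1) (entry b.2)
    (entry y) (entry p.1) (entry p.2) i)

section paths
variable {Ω : Type*} [MeasurableSpace Ω]

theorem measurableSet_path {α : Type*} [MeasurableSpace α] [MeasurableSingletonClass α]
    {Z : ℕ → Ω → α} (n : ℕ) (hZ : ∀ j ≤ n, Measurable (Z j)) (P : ℕ → α) :
    MeasurableSet {ω | ∀ j ≤ n, Z j ω = P j} := by
  have : {ω | ∀ j ≤ n, Z j ω = P j} = ⋂ j, ⋂ (_ : j ≤ n), Z j ⁻¹' {P j} := by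
    ext ω; simp
  rw [this]
  exact MeasurableSet.iInter fun j => MeasurableSet.iInter fun hj =>
    hZ j hj (measurableSet_singleton _)

variable {μ : Measure Ω} {q : ℝ} {ξ : Ω → ℕ → ℕ → ℕ → ℕ}

theorem measurable_pairAt_of_noise (hξ : IsGeometricNoise q μ ξ) (k n : ℕ) :
    Measurable fun ω => pairAt (ξ ω) k n :=
  measurable_pairAt n k fun t' _ k' _ i hi hi' => hξ.meas ⟨(t', k', i), hi, hi'⟩

theorem measureReal_two_levels (hξ : IsGeometricNoise q μ ξ) (k : ℕ) {n N : ℕ} (hn : n ≤ N)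
    (P : ℕ → Pos (k / 2) × Pos ((k + 1) / 2))
    (P' : ℕ → Pos ((k + 1) / 2) × Pos ((k + 1 + 1) / 2)) (h0 : P' 0 = 0) :
    μ.real {ω | (∀ j ≤ N, pairAt (ξ ω) k j = P j) ∧ ∀ j ≤ n, pairAt (ξ ω) (k + 1) j = P' j} =
      μ.real {ω | ∀ j ≤ N, pairAt (ξ ω) k j = P j} *
        ∏ m ∈ Finset.range n, moveProb μ ξ k m (P m).2 (P (m + 1)) (P' m).2 (P' (m + 1)) := by
  set m : NoiseIndex → MeasurableSpace Ω := fun p =>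
    MeasurableSpace.comap (fun ω => ξ ω p.1.1 p.1.2.1 p.1.2.2) ⊤ with hm
  have hmle : ∀ p, m p ≤ ‹MeasurableSpace Ω› := fun p => (hξ.meas p).comap_le
  have hmi : iIndep m μ := (iIndepFun_iff_iIndep _ _ _).1 hξ.indep
  set S₀ : Set NoiseIndex := {p | p.1.2.1 ≤ k} with hS₀
  set S : ℕ × ℕ → Set NoiseIndex := fun a =>
    {p | (p.1.1 = 2 * a.1 + 1 ∨ p.1.1 = 2 * a.1 + 2) ∧ p.1.2.1 = k + 1 ∧ p.1.2.2 = a.2 + 1} with hS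
  have hnoise : ∀ (T : Set NoiseIndex) (p : NoiseIndex), p ∈ T →
      Measurable[⨆ i ∈ T, m i] fun ω => ξ ω p.1.1 p.1.2.1 p.1.2.2 := fun T p hp =>
    measurable_iff_comap_le.2 (le_biSup m hp)
  set E₀ : Set Ω := {ω | ∀ j ≤ N, pairAt (ξ ω) k j = P j} with hE₀
  set E : ℕ × ℕ → Set Ω := fun a => moveEvent ξ k a.1 (entry (P a.1).2) (entry (P (a.1 + 1)).1)
    (entry (P (a.1 + 1)).2) (entry (P' a.1).2) (entry (P' (a.1 + 1)).1) (entry (P' (a.1 + 1)).2) a.2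
    with hE
  have key := measureReal_inter_biInter hmle hmi S₀ S ?_ ?_ E₀ E
    (Finset.range n ×ˢ Finset.range ((k + 1 + 1) / 2)) ?_ ?_
  · rw [Finset.prod_product] at key
    rw [show (∏ m ∈ Finset.range n, moveProb μ ξ k m (P m).2 (P (m + 1)) (P' m).2 (P' (m + 1))) =
      ∏ x ∈ Finset.range n, ∏ y ∈ Finset.range ((k + 1 + 1) / 2), μ.real (E (x, y)) from rfl, ← key]
    congr 1
    ext ω
    simp only [Set.mem_inter_iff, Set.mem_iInter, Finset.mem_product, Finset.mem_range,
      Set.mem_ofPred_eq, hE₀]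
    refine and_congr_right fun hω => ?_
    have step : ∀ j < n, pairAt (ξ ω) (k + 1) j = P' j →
        (pairAt (ξ ω) (k + 1) (j + 1) = P' (j + 1) ↔
          ∀ i < (k + 1 + 1) / 2, ω ∈ E (j, i)) := by
      intro j hj hPj
      have e1 : (P j).2 = levelAt (ξ ω) k j := (congrArg Prod.snd (hω j (by omega))).symm
      have e2 : (P' j).2 = levelAt (ξ ω) (k + 1) j := (congrArg Prod.snd hPj).symm
      rw [pairAt_succ_iff, hω (j + 1) (by omega), ← e1, ← e2]
      rfl
    constructor
    · intro h a ha
      exact (step a.1 ha.1 (h _ (by omega))).1 (h _ (by omega)) a.2 ha.2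
    · intro h j
      induction j with
      | zero => intro _; rw [h0]; rfl
      | succ j ih =>
        intro hj
        exact (step j (by omega) (ih (by omega))).2 fun i hi => h (j, i) ⟨by omega, hi⟩
  · intro a
    refine Set.disjoint_left.2 fun p hp hp' => ?_
    simp only [hS₀, hS, Set.mem_ofPred_eq] at hp hp'
    omega
  · intro a a' haa'
    refine Set.disjoint_left.2 fun p hp hp' => haa' ?_
    simp only [hS, Set.mem_ofPred_eq] at hp hp'
    ext <;> omega
  · refine @measurableSet_path Ω (⨆ i ∈ S₀, m i) _ _ _ (fun j ω => pairAt (ξ ω) k j) N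
      (fun j _ => ?_) P
    exact @measurable_pairAt Ω (⨆ i ∈ S₀, m i) ξ j k fun t' _ k' hk' i hi hi' =>
      hnoise S₀ ⟨(t', k', i), hi, hi'⟩ hk'
  · intro a ha
    rw [Finset.mem_product, Finset.mem_range, Finset.mem_range] at ha
    have n1 : 1 ≤ a.2 + 1 ∧ a.2 + 1 ≤ (k + 1 + 1) / 2 := by omega
    have h1 := hnoise (S a) ⟨(2 * a.1 + 1, k + 1, a.2 + 1), n1⟩
      ⟨Or.inl rfl, rfl, rfl⟩
    have h2 := hnoise (S a) ⟨(2 * a.1 + 2, k + 1, a.2 + 1), n1⟩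
      ⟨Or.inr rfl, rfl, rfl⟩
    exact (h1.prodMk h2) (Set.to_countable {e : ℕ × ℕ | MovesTo ((k + 1) / 2)
      (entry (P a.1).2) (entry (P (a.1 + 1)).1) (entry (P (a.1 + 1)).2) (entry (P' a.1).2)
      (entry (P' (a.1 + 1)).1) (entry (P' (a.1 + 1)).2) a.2 e.1 e.2}).measurableSet

theorem moveProb_eq_transLaw [IsProbabilityMeasure μ] (hq0 : 0 < q) (hq1 : q < 1)
    (hξ : IsGeometricNoise q μ ξ) (k m N : ℕ)
    (x : Pos ((k + 1) / 2)) (b : Pos (k / 2) × Pos ((k + 1) / 2)) (y : Pos ((k + 1 + 1) / 2))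
    (p : Pos ((k + 1) / 2) × Pos ((k + 1 + 1) / 2)) (hxy : Interlace x y) (hbx : Interlace b.1 x)
    (hbx' : Interlace b.1 b.2) (hy : ∀ i, entry y i < N) (hp : ∀ i, entry p.2 i < N)
    (hb : ∀ i, entry b.2 i < N) :
    moveProb μ ξ k m x b y p = transLaw q N x b.1 b.2 y p.1 p.2 := by
  refine Finset.prod_congr rfl fun i hi => ?_
  rw [Finset.mem_range] at hi
  rw [interlace_iff] at hxy hbx hbx'
  have n1 : 1 ≤ i + 1 ∧ i + 1 ≤ (k + 1 + 1) / 2 := by omega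
  have g1 := hξ.geom ⟨(2 * m + 1, k + 1, i + 1), n1⟩
  have g2 := hξ.geom ⟨(2 * m + 2, k + 1, i + 1), n1⟩
  have m1 := hξ.meas ⟨(2 * m + 1, k + 1, i + 1), n1⟩
  have m2 := hξ.meas ⟨(2 * m + 2, k + 1, i + 1), n1⟩
  have hne : (⟨(2 * m + 1, k + 1, i + 1), n1⟩ : NoiseIndex) ≠
      ⟨(2 * m + 2, k + 1, i + 1), n1⟩ := by
    intro h
    have := congrArg (fun p : NoiseIndex => p.1.1) h
    simp only at this
    omega
  have ind := hξ.indep.indepFun hne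
  simp only at g1 g2 m1 m2 ind
  have hcap : ∀ z z', z < N ∨ z' < N →
      (z' = capPush (entry b.1) i z ↔ z' = min (capAt N (entry b.1) i) z) := by
    intro z z' hz
    unfold capPush capAt
    split_ifs
    · omega
    · rfl
  have hcapy : capPush (entry b.1) i (entry y i) =
      min (capAt N (entry b.1) i) (entry y i) := (hcap _ _ (Or.inl (hy i))).1 rfl
  unfold particleLaw moveEvent MovesTo
  simp only [hcapy, hcap _ _ (Or.inr (hp i))]
  have hcase : ∀ z, (∀ j, i = j + 1 → z ≤ entry b.1 j) → z < N → z ≤ capAt N (entry b.1) i := by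
    intro z h hz
    cases i with
    | zero => exact hz.le
    | succ j => exact h j rfl
  split_ifs with hib
  · simp only [hib, forall_true_left]
    have hxle := hxy.1 i hib hi
    have hxi := hy i
    refine measureReal_leftJump_rightJump m1 m2 ind g1 g2 ?_ (min_le_left _ _) ?_ _ _
    · refine le_min (hcase _ ?_ (by omega)) hxle
      rintro j rfl
      exact hbx.2 j (by omega) hib
    · refine hcase _ ?_ (hb i)
      rintro j rfl
      exact hbx'.2 j (by omega) hib
  · simp only [hib, false_imp_iff, true_and]
    exact measureReal_wallJump hq0 hq1 m1 m2 ind g1 g2 _ _ _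

end paths

theorem antitone_of_entry_succ_le {n : ℕ} {y : Pos n}
    (h : ∀ i, i + 1 < n → entry y (i + 1) ≤ entry y i) : Antitone y := by
  intro i j hij
  have key : ∀ d, (i : ℕ) + d < n → entry y (i + d) ≤ entry y i := by
    intro d
    induction d with
    | zero => intro _; exact le_rfl
    | succ d ih => intro hd; exact (h (i + d) hd).trans (ih (by omega))
  have := key (j - i) (by omega)
  rwa [show (i : ℕ) + (j - i) = j by omega, entry_val, entry_val] at this

theorem Interlace.antitone {a b : ℕ} {c : Pos a} {y : Pos b} (h : Interlace c y)
    (hab : b ≤ a + 1) : Antitone y := by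
  rw [interlace_iff] at h
  exact antitone_of_entry_succ_le fun i hi =>
    (h.2 i (by omega) hi).trans (h.1 i (by omega) (by omega))

theorem Interlace.antitone_left {a b : ℕ} {c : Pos a} {y : Pos b} (h : Interlace c y)
    (hab : a ≤ b) : Antitone c := by
  rw [interlace_iff] at h
  exact antitone_of_entry_succ_le fun i hi =>
    (h.1 (i + 1) hi (by omega)).trans (h.2 i (by omega) (by omega))

theorem Interlace.entry_lt {a b N : ℕ} {c : Pos a} {y : Pos b} (h : Interlace c y) (hab : a ≤ b)
    (hN : ∀ i, entry y i < N) : c ∈ Fintype.piFinset (fun _ : Fin a => Finset.range N) := by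
  rw [Fintype.mem_piFinset]
  intro i
  rw [interlace_iff] at h
  have := h.1 i i.2 (by omega)
  rw [entry_val] at this
  exact Finset.mem_range.2 (this.trans_lt (hN _))

theorem exists_entry_lt {n : ℕ} (y : Pos n) : ∃ N, ∀ i, entry y i < N := by
  refine ⟨(∑ i, y i) + 1, fun i => Nat.lt_succ_of_le ?_⟩
  by_cases h : i < n
  · rw [entry_of_lt y h]
    exact Finset.single_le_sum (f := y) (fun _ _ => Nat.zero_le _) (Finset.mem_univ _)
  · rw [entry, dif_neg h]; exact Nat.zero_le _

theorem interlace_of_jumpWeight_ne_zero {q : ℝ} {k : ℕ} {y : Pos ((k + 1) / 2)} {c : Pos (k / 2)}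
    {y' : Pos ((k + 1) / 2)} (h : jumpWeight q k y c y' ≠ 0) : Interlace c y ∧ Interlace c y' := by
  by_contra hc
  exact h (if_neg hc)

theorem levelWeight_nonneg {q : ℝ} (hq0 : 0 < q) (hq1 : q < 1) {a b : ℕ} (y : Pos b) (c : Pos a)
    (y' : Pos b) : 0 ≤ levelWeight q y c y' := by
  have h1 : 0 < 1 - q := by linarith
  unfold levelWeight
  split_ifs
  · have := wallKernel_pos hq0 hq1 (entry y a) (entry y' a)
    positivity
  · positivity
  · exact le_rfl

theorem jumpWeight_nonneg {q : ℝ} (hq0 : 0 < q) (hq1 : q < 1) (k : ℕ) (y : Pos ((k + 1) / 2))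
    (c : Pos (k / 2)) (y' : Pos ((k + 1) / 2)) : 0 ≤ jumpWeight q k y c y' := by
  by_cases h : jumpWeight q k y c y' = 0
  · exact h.ge
  · obtain ⟨h1, h2⟩ := interlace_of_jumpWeight_ne_zero h
    rw [jumpWeight_eq hq0]
    exact mul_nonneg (div_pos (sFun_pos k (h2.antitone (by omega)))
      (sFun_pos k (h1.antitone (by omega)))).le (levelWeight_nonneg hq0 hq1 _ _ _)

theorem jumpWeight_pos {q : ℝ} (hq0 : 0 < q) (hq1 : q < 1) (k : ℕ) {y : Pos ((k + 1) / 2)}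
    {c : Pos (k / 2)} {y' : Pos ((k + 1) / 2)} (h1 : Interlace c y) (h2 : Interlace c y') :
    0 < jumpWeight q k y c y' := by
  rw [jumpWeight_eq hq0]
  refine mul_pos (div_pos (sFun_pos k (h2.antitone (by omega)))
      (sFun_pos k (h1.antitone (by omega)))) ?_
  have h3 : 0 < 1 - q := by linarith
  rw [levelWeight, if_pos ⟨h1, h2⟩]
  have := wallKernel_pos hq0 hq1 (entry y (k / 2)) (entry y' (k / 2))
  split_ifs <;> positivity

/-- The law of the paths of the pair process of level `k`. -/
def HasPathLaw {Ω : Type*} [MeasurableSpace Ω] (q : ℝ) (μ : Measure Ω)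
    (ξ : Ω → ℕ → ℕ → ℕ → ℕ) (k : ℕ) : Prop :=
  ∀ (n : ℕ) (P : ℕ → Pos (k / 2) × Pos ((k + 1) / 2)),
    μ.real {ω | ∀ j ≤ n, pairAt (ξ ω) k j = P j} =
      if P 0 = 0 then ∏ j ∈ Finset.range n, kernelS q k (P j) (P (j + 1)) else 0

section main
variable {Ω : Type*} [MeasurableSpace Ω] {μ : Measure Ω} [IsProbabilityMeasure μ] {q : ℝ}
  {ξ : Ω → ℕ → ℕ → ℕ → ℕ}

theorem hasPathLaw_zero (hq0 : 0 < q) : HasPathLaw q μ ξ 0 := by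
  intro n P
  have h1 : IsEmpty (Fin (0 / 2)) := inferInstanceAs (IsEmpty (Fin 0))
  have h2 : IsEmpty (Fin ((0 + 1) / 2)) := inferInstanceAs (IsEmpty (Fin 0))
  have hS : ∀ p p', kernelS q 0 p p' = 1 := by
    intro p p'
    have hi : ∀ (c : Pos (0 / 2)) (y : Pos ((0 + 1) / 2)), Interlace c y := fun c y =>
      ⟨fun i => h1.elim i, fun i => h1.elim i⟩
    rw [kernelS, jumpWeight_eq hq0, Subsingleton.elim p.2 p'.2,
      div_self (sFun_pos 0 ((hi p.1 p'.2).antitone (by omega))).ne', levelWeight,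
      if_pos ⟨hi _ _, hi _ _⟩]
    simp
  have hu : {ω | ∀ j ≤ n, pairAt (ξ ω) 0 j = P j} = Set.univ := by
    ext ω
    simp only [Set.mem_ofPred_eq, Set.mem_univ, iff_true]
    exact fun j _ => Subsingleton.elim _ _
  rw [hu, if_pos (Subsingleton.elim _ _)]
  simp [hS]

/-- Given the past of level `k + 1` and the present position of level `k`, the pair of levels
makes its next move according to the kernel of level `k` and the noise of level `k + 1`. -/
theorem measureReal_step (hξ : IsGeometricNoise q μ ξ) {k : ℕ} (hk : HasPathLaw q μ ξ k) (n : ℕ)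
    (x : Pos ((k + 1) / 2)) (b : Pos (k / 2) × Pos ((k + 1) / 2))
    (P' : ℕ → Pos ((k + 1) / 2) × Pos ((k + 1 + 1) / 2)) (h0 : P' 0 = 0) :
    μ.real {ω | (∀ j ≤ n + 1, pairAt (ξ ω) (k + 1) j = P' j) ∧ levelAt (ξ ω) k n = x ∧
        pairAt (ξ ω) k (n + 1) = b} =
      μ.real {ω | (∀ j ≤ n, pairAt (ξ ω) (k + 1) j = P' j) ∧ levelAt (ξ ω) k n = x} *
        (jumpWeight q k x b.1 b.2 * moveProb μ ξ k n x b (P' n).2 (P' (n + 1))) := by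
  have mZ := measurable_pairAt_of_noise hξ k
  have mZ' := measurable_pairAt_of_noise hξ (k + 1)
  have mX : Measurable fun ω => levelAt (ξ ω) k n := (mZ n).snd
  set Y : Ω → Fin (n + 1) → Pos (k / 2) × Pos ((k + 1) / 2) := fun ω j => pairAt (ξ ω) k j with hY
  have mY : Measurable Y := measurable_pi_lambda _ fun j => mZ j
  have mA : MeasurableSet {ω | (∀ j ≤ n, pairAt (ξ ω) (k + 1) j = P' j) ∧
      levelAt (ξ ω) k n = x} :=
    (measurableSet_path n (fun j _ => mZ' j) P').inter (mX (measurableSet_singleton x))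
  have mB : MeasurableSet {ω | (∀ j ≤ n + 1, pairAt (ξ ω) (k + 1) j = P' j) ∧
      levelAt (ξ ω) k n = x ∧ pairAt (ξ ω) k (n + 1) = b} :=
    (measurableSet_path (n + 1) (fun j _ => mZ' j) P').inter
      ((mX (measurableSet_singleton x)).inter (mZ (n + 1) (measurableSet_singleton b)))
  refine (hasSum_measureReal_inter (μ := μ) mY mB).unique ?_
  have hs := (hasSum_measureReal_inter (μ := μ) mY mA).mul_right
    (jumpWeight q k x b.1 b.2 * moveProb μ ξ k n x b (P' n).2 (P' (n + 1)))
  refine Eq.mp (congrArg (fun f => HasSum f _) (funext fun Q => Eq.symm ?_)) hs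
  by_cases hQ : (Q (Fin.last n)).2 = x
  · set P : ℕ → Pos (k / 2) × Pos ((k + 1) / 2) := fun j =>
      if h : j ≤ n then Q ⟨j, by omega⟩ else b with hP
    have hPQ : ∀ j (h : j ≤ n), P j = Q ⟨j, by omega⟩ := fun j h => dif_pos h
    have hPb : P (n + 1) = b := dif_neg (by omega)
    have hPn : (P n).2 = x := by rw [hPQ n le_rfl, ← hQ]; rfl
    have hYQ : ∀ ω, Y ω = Q ↔ ∀ j ≤ n, pairAt (ξ ω) k j = P j := by
      intro ω
      rw [funext_iff]
      constructor
      · intro h j hj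
        rw [hPQ j hj, ← h]
      · intro h j
        exact (h j (by omega)).trans (hPQ j (by omega))
    have e1 : {ω | ω ∈ {ω | (∀ j ≤ n + 1, pairAt (ξ ω) (k + 1) j = P' j) ∧
        levelAt (ξ ω) k n = x ∧ pairAt (ξ ω) k (n + 1) = b} ∧ Y ω = Q} =
        {ω | (∀ j ≤ n + 1, pairAt (ξ ω) k j = P j) ∧
          ∀ j ≤ n + 1, pairAt (ξ ω) (k + 1) j = P' j} := by
      ext ω
      simp only [Set.mem_ofPred_eq, hYQ]
      constructor
      · rintro ⟨⟨h1, -, h2⟩, h3⟩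
        refine ⟨fun j hj => ?_, h1⟩
        rcases Nat.lt_or_ge n j with h | h
        · obtain rfl : j = n + 1 := by omega
          rw [h2, hPb]
        · exact h3 j h
      · rintro ⟨h1, h2⟩
        exact ⟨⟨h2, (congrArg Prod.snd (h1 n (by omega))).trans hPn, (h1 _ le_rfl).trans hPb⟩,
          fun j hj => h1 j (by omega)⟩
    have e2 : {ω | ω ∈ {ω | (∀ j ≤ n, pairAt (ξ ω) (k + 1) j = P' j) ∧
        levelAt (ξ ω) k n = x} ∧ Y ω = Q} =
        {ω | (∀ j ≤ n, pairAt (ξ ω) k j = P j) ∧ ∀ j ≤ n, pairAt (ξ ω) (k + 1) j = P' j} := by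
      ext ω
      simp only [Set.mem_ofPred_eq, hYQ]
      constructor
      · rintro ⟨⟨h1, -⟩, h3⟩
        exact ⟨h3, h1⟩
      · rintro ⟨h1, h2⟩
        exact ⟨⟨h2, (congrArg Prod.snd (h1 n le_rfl)).trans hPn⟩, h1⟩
    rw [e1, e2, measureReal_two_levels hξ k le_rfl P P' h0,
      measureReal_two_levels hξ k le_rfl P P' h0, hk, hk, Finset.prod_range_succ,
      Finset.prod_range_succ, hPn, hPb, kernelS, hPn]
    split_ifs <;> ring
  · have hne : ∀ ω, levelAt (ξ ω) k n = x → ¬ Y ω = Q := by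
      rintro ω h rfl
      exact hQ h
    rw [show {ω | ω ∈ {ω | (∀ j ≤ n + 1, pairAt (ξ ω) (k + 1) j = P' j) ∧
        levelAt (ξ ω) k n = x ∧ pairAt (ξ ω) k (n + 1) = b} ∧ Y ω = Q} = ∅ by
          ext ω; exact ⟨fun h => hne ω h.1.2.1 h.2, False.elim⟩,
      show {ω | ω ∈ {ω | (∀ j ≤ n, pairAt (ξ ω) (k + 1) j = P' j) ∧
        levelAt (ξ ω) k n = x} ∧ Y ω = Q} = ∅ by
          ext ω; exact ⟨fun h => hne ω h.1.2 h.2, False.elim⟩]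
    simp

/-- Given the past of level `k + 1`, the law of the position of level `k` is a Gibbs measure. -/
theorem measureReal_gibbs (hq0 : 0 < q) (hq1 : q < 1) (hξ : IsGeometricNoise q μ ξ) {k : ℕ}
    (hk : HasPathLaw q μ ξ k) (n : ℕ) (x' : Pos ((k + 1) / 2))
    (P' : ℕ → Pos ((k + 1) / 2) × Pos ((k + 1 + 1) / 2)) (h0 : P' 0 = 0) :
    μ.real {ω | (∀ j ≤ n, pairAt (ξ ω) (k + 1) j = P' j) ∧ levelAt (ξ ω) k n = x'} =
      (∏ j ∈ Finset.range n, kernelS q (k + 1) (P' j) (P' (j + 1))) *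
        (if Interlace x' (P' n).2 then sFun k x' / sFun (k + 1) (P' n).2 else 0) := by
  induction n generalizing x' with
  | zero =>
    have hx : Interlace x' (0 : Pos ((k + 1 + 1) / 2)) ↔ 0 = x' := by
      rw [interlace_iff]
      have e0 : ∀ i, entry (0 : Pos ((k + 1 + 1) / 2)) i = 0 := by
        intro i; unfold entry; split_ifs <;> rfl
      simp only [e0, Nat.zero_le, implies_true, and_true, nonpos_iff_eq_zero]
      constructor
      · intro h
        ext i
        have := h i i.2 (by omega)
        rw [entry_val] at this
        exact this.symm
      · rintro rfl i _ _
        unfold entry; split_ifs <;> rfl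
    have hset : {ω | (∀ j ≤ 0, pairAt (ξ ω) (k + 1) j = P' j) ∧ levelAt (ξ ω) k 0 = x'} =
        {_ω | (0 : Pos ((k + 1) / 2)) = x'} := by
      ext ω
      simp only [Set.mem_ofPred_eq, nonpos_iff_eq_zero, forall_eq, h0, pairAt_zero, true_and]
      rfl
    rw [hset]
    simp only [Finset.range_zero, Finset.prod_empty, one_mul, h0, Prod.snd_zero, hx]
    by_cases h : (0 : Pos ((k + 1) / 2)) = x'
    · subst h
      have hs : ∀ k, sFun k (0 : Pos ((k + 1) / 2)) = 1 := by
        intro k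
        have := (sFun_pos k (x := (0 : Pos ((k + 1) / 2))) fun _ _ _ => le_rfl).ne'
        rw [sFun_eq] at this ⊢
        exact div_self fun h => this (by rw [h, div_zero])
      simp [hs]
    · simp [h]
  | succ n ih =>
    obtain ⟨N₁, hN₁⟩ := exists_entry_lt (P' n).2
    obtain ⟨N₂, hN₂⟩ := exists_entry_lt (P' (n + 1)).2
    obtain ⟨N₃, hN₃⟩ := exists_entry_lt x'
    set N := max N₁ (max N₂ N₃) with hN
    have hN₁' : ∀ i, entry (P' n).2 i < N := fun i => by have := hN₁ i; omega
    have hN₂' : ∀ i, entry (P' (n + 1)).2 i < N := fun i => by have := hN₂ i; omega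
    have hN₃' : ∀ i, entry x' i < N := fun i => by have := hN₃ i; omega
    set W := ∏ j ∈ Finset.range n, kernelS q (k + 1) (P' j) (P' (j + 1)) with hW
    have mZ := measurable_pairAt_of_noise hξ k
    have mZ' := measurable_pairAt_of_noise hξ (k + 1)
    have mA : MeasurableSet {ω | (∀ j ≤ n + 1, pairAt (ξ ω) (k + 1) j = P' j) ∧
        levelAt (ξ ω) k (n + 1) = x'} :=
      (measurableSet_path (n + 1) (fun j _ => mZ' j) P').inter
        ((mZ (n + 1)).snd (measurableSet_singleton x'))
    have hsum := hasSum_measureReal_inter (μ := μ)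
      ((mZ n).snd.prodMk (mZ (n + 1)).fst) mA
    have hterm : ∀ p : Pos ((k + 1) / 2) × Pos (k / 2),
        μ.real {ω | ω ∈ {ω | (∀ j ≤ n + 1, pairAt (ξ ω) (k + 1) j = P' j) ∧
          levelAt (ξ ω) k (n + 1) = x'} ∧
          ((pairAt (ξ ω) k n).2, (pairAt (ξ ω) k (n + 1)).1) = p} =
        W * (sFun k x' / sFun (k + 1) (P' n).2) *
          (if Interlace p.1 (P' n).2 then levelWeight q p.1 p.2 x' *
            transLaw q N p.1 p.2 x' (P' n).2 (P' (n + 1)).1 (P' (n + 1)).2 else 0) := by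
      rintro ⟨x, u⟩
      have e : {ω | ω ∈ {ω | (∀ j ≤ n + 1, pairAt (ξ ω) (k + 1) j = P' j) ∧
          levelAt (ξ ω) k (n + 1) = x'} ∧
          ((pairAt (ξ ω) k n).2, (pairAt (ξ ω) k (n + 1)).1) = (x, u)} =
          {ω | (∀ j ≤ n + 1, pairAt (ξ ω) (k + 1) j = P' j) ∧ levelAt (ξ ω) k n = x ∧
            pairAt (ξ ω) k (n + 1) = (u, x')} := by
        ext ω
        simp only [Set.mem_ofPred_eq, Prod.ext_iff, pairAt]
        tauto
      rw [e, measureReal_step hξ hk n x (u, x') P' h0, ih]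
      by_cases hx : Interlace x (P' n).2
      · rw [if_pos hx, if_pos hx]
        have hsx := (sFun_pos k (hx.antitone_left (by omega))).ne'
        by_cases hu : Interlace u x ∧ Interlace u x'
        · rw [moveProb_eq_transLaw hq0 hq1 hξ k n N x (u, x') _ _ hx hu.1 hu.2 hN₁' hN₂' hN₃',
            jumpWeight_eq hq0]
          field_simp
        · rw [jumpWeight, if_neg hu, levelWeight, if_neg hu]
          ring
      · rw [if_neg hx, if_neg hx]
        ring
    simp_rw [hterm] at hsum
    refine hsum.unique ?_
    have hfin := hasSum_sum_of_ne_finset_zero (L := SummationFilter.unconditional _)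
      (s := Fintype.piFinset (fun _ : Fin ((k + 1) / 2) => Finset.range N) ×ˢ
        Fintype.piFinset (fun _ : Fin (k / 2) => Finset.range N))
      (f := fun p : Pos ((k + 1) / 2) × Pos (k / 2) => W * (sFun k x' / sFun (k + 1) (P' n).2) *
          (if Interlace p.1 (P' n).2 then levelWeight q p.1 p.2 x' *
            transLaw q N p.1 p.2 x' (P' n).2 (P' (n + 1)).1 (P' (n + 1)).2 else 0)) ?_
    · convert hfin using 1
      rw [← Finset.mul_sum, Finset.sum_product,
        sum_weight_mul_transLaw hq0 hq1 N (by omega) (by omega) x' _ _ _ hN₁' hN₂',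
        Finset.prod_range_succ, ← hW, kernelS, jumpWeight_eq hq0]
      by_cases hv : Interlace (P' (n + 1)).1 (P' n).2 ∧ Interlace (P' (n + 1)).1 (P' (n + 1)).2
      · have h1 := (sFun_pos (k + 1) (hv.2.antitone (by omega))).ne'
        split_ifs
        · field_simp
        · simp
      · rw [levelWeight, if_neg hv]
        simp
    · rintro ⟨x, u⟩ hxu
      by_cases hx : Interlace x (P' n).2
      · have hu : ¬ (Interlace u x ∧ Interlace u x') := by
          rintro ⟨hu, -⟩
          refine hxu (Finset.mem_product.2 ⟨hx.entry_lt (by omega) hN₁', ?_⟩)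
          have hxN := hx.entry_lt (by omega) hN₁'
          rw [Fintype.mem_piFinset] at hxN
          refine hu.entry_lt (by omega) fun i => ?_
          by_cases hi : i < (k + 1) / 2
          · rw [entry_of_lt x hi]; exact Finset.mem_range.1 (hxN ⟨i, hi⟩)
          · rw [entry, dif_neg hi]; have := hN₁' 0; omega
        simp only
        rw [levelWeight, if_neg hu]
        simp
      · simp only
        rw [if_neg hx, mul_zero]

theorem hasPathLaw_succ (hq0 : 0 < q) (hq1 : q < 1) (hξ : IsGeometricNoise q μ ξ) {k : ℕ}
    (hk : HasPathLaw q μ ξ k) : HasPathLaw q μ ξ (k + 1) := by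
  intro n P
  split_ifs with h0
  · have mZ := measurable_pairAt_of_noise hξ (k + 1)
    have hsum := hasSum_measureReal_inter (μ := μ) (measurable_pairAt_of_noise hξ k n).snd
      (measurableSet_path n (fun j _ => mZ j) P)
    have hg := measureReal_gibbs hq0 hq1 hξ hk n
    refine hsum.unique ?_
    rw [show (fun b => μ.real {ω | ω ∈ {ω | ∀ j ≤ n, pairAt (ξ ω) (k + 1) j = P j} ∧
      (pairAt (ξ ω) k n).2 = b}) = fun x => (∏ j ∈ Finset.range n,
        kernelS q (k + 1) (P j) (P (j + 1))) *
        (if Interlace x (P n).2 then sFun k x / sFun (k + 1) (P n).2 else 0) from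
      funext fun x => hg x P h0]
    by_cases hw : ∏ j ∈ Finset.range n, kernelS q (k + 1) (P j) (P (j + 1)) = 0
    · rw [hw]
      simp
    · have hanti : Antitone (P n).2 := by
        cases n with
        | zero => rw [h0]; exact fun _ _ _ => le_rfl
        | succ n =>
          rw [Finset.prod_range_succ] at hw
          exact (interlace_of_jumpWeight_ne_zero (right_ne_zero_of_mul hw)).2.antitone (by omega)
      obtain ⟨N, hN⟩ := exists_entry_lt (P n).2
      have hfin := hasSum_sum_of_ne_finset_zero (L := SummationFilter.unconditional _)
        (s := Fintype.piFinset (fun _ : Fin ((k + 1) / 2) => Finset.range N))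
        (f := fun x => (if Interlace x (P n).2 then sFun k x / sFun (k + 1) (P n).2 else 0))
        (fun x hx => if_neg fun h => hx (h.entry_lt (by omega) hN))
      have hone : ∑ x ∈ Fintype.piFinset (fun _ : Fin ((k + 1) / 2) => Finset.range N),
          (if Interlace x (P n).2 then sFun k x / sFun (k + 1) (P n).2 else 0) = 1 := by
        have hb := sum_sFun k N (P n).2 hanti hN
        have hs := (sFun_pos (k + 1) hanti).ne'
        rw [← div_self hs]
        nth_rewrite 2 [← hb]
        rw [Finset.sum_div]
        refine Finset.sum_congr rfl fun x _ => ?_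
        split_ifs
        · rfl
        · simp
      rw [hone] at hfin
      simpa using hfin.mul_left (∏ j ∈ Finset.range n, kernelS q (k + 1) (P j) (P (j + 1)))
  · rw [show {ω | ∀ j ≤ n, pairAt (ξ ω) (k + 1) j = P j} = ∅ by
      ext ω
      exact ⟨fun h => h0 (h 0 (Nat.zero_le _)).symm, False.elim⟩]
    simp

theorem hasPathLaw (hq0 : 0 < q) (hq1 : q < 1) (hξ : IsGeometricNoise q μ ξ) (k : ℕ) :
    HasPathLaw q μ ξ k := by
  induction k with
  | zero => exact hasPathLaw_zero hq0
  | succ k ih => exact hasPathLaw_succ hq0 hq1 hξ ih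

end main

/-- The first `n` entries of a configuration, followed by zeros. -/
def truncatePos {r : ℕ} (y : Pos r) (n : ℕ) : Pos r := fun i => if (i : ℕ) < n then y i else 0

theorem entry_truncatePos {r : ℕ} (y : Pos r) (n i : ℕ) :
    entry (truncatePos y n) i = if i < n then entry y i else 0 := by
  unfold entry truncatePos
  split_ifs <;> rfl

/-- Every state can be reached from the zero state. -/
theorem exists_path (k : ℕ) {y : Pos ((k + 1) / 2)} (hy : Antitone y) :
    ∃ (n : ℕ) (P : ℕ → Pos (k / 2) × Pos ((k + 1) / 2)), P 0 = 0 ∧ (P n).2 = y ∧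
      ∀ j, Interlace (P (j + 1)).1 (P j).2 ∧ Interlace (P (j + 1)).1 (P (j + 1)).2 := by
  refine ⟨(k + 1) / 2, fun j => (fun i => entry (truncatePos y (j - 1)) i, truncatePos y j),
    ?_, ?_, fun j => ?_⟩
  · refine Prod.ext (funext fun i => ?_) (funext fun i => ?_)
    · simp [entry_truncatePos]
    · simp [truncatePos]
  · funext i
    simp [truncatePos]
  · have hc : ∀ i < k / 2, entry (fun i : Fin (k / 2) => entry (truncatePos y (j + 1 - 1)) i) i =
        if i < j then entry y i else 0 := by
      intro i hi
      rw [entry_of_lt _ hi, entry_truncatePos, Nat.add_sub_cancel]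
    simp only [interlace_iff]
    refine ⟨⟨fun i hi _ => ?_, fun i hi _ => ?_⟩, ⟨fun i hi _ => ?_, fun i hi _ => ?_⟩⟩ <;>
      rw [hc i hi] <;> have := entry_succ_le hy i <;> simp only [entry_truncatePos] <;>
      split_ifs <;> omega

section final
variable {Ω : Type*} [MeasurableSpace Ω] {μ : Measure Ω} [IsProbabilityMeasure μ] {q : ℝ}
  {ξ : Ω → ℕ → ℕ → ℕ → ℕ}

theorem measureReal_pairAt_step (hq0 : 0 < q) (hq1 : q < 1) (hξ : IsGeometricNoise q μ ξ) (k : ℕ)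
    (n : ℕ) (P : ℕ → Pos (k / 2) × Pos ((k + 1) / 2)) (b : Pos (k / 2) × Pos ((k + 1) / 2)) :
    μ.real {ω | (∀ j ≤ n, pairAt (ξ ω) k j = P j) ∧ pairAt (ξ ω) k (n + 1) = b} =
      μ.real {ω | ∀ j ≤ n, pairAt (ξ ω) k j = P j} * kernelS q k (P n) b := by
  set P' : ℕ → Pos (k / 2) × Pos ((k + 1) / 2) := fun j => if j ≤ n then P j else b with hP'
  have h1 : ∀ j ≤ n, P' j = P j := fun j hj => if_pos hj
  have h2 : P' (n + 1) = b := if_neg (by omega)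
  have e : {ω | (∀ j ≤ n, pairAt (ξ ω) k j = P j) ∧ pairAt (ξ ω) k (n + 1) = b} =
      {ω | ∀ j ≤ n + 1, pairAt (ξ ω) k j = P' j} := by
    ext ω
    simp only [Set.mem_ofPred_eq]
    constructor
    · rintro ⟨h, hb⟩ j hj
      rcases Nat.lt_or_ge n j with h' | h'
      · obtain rfl : j = n + 1 := by omega
        rw [hb, h2]
      · rw [h j h', h1 j h']
    · intro h
      exact ⟨fun j hj => (h j (by omega)).trans (h1 j hj), (h _ le_rfl).trans h2⟩
  rw [e, hasPathLaw hq0 hq1 hξ k, hasPathLaw hq0 hq1 hξ k, Finset.prod_range_succ, h2,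
    h1 n le_rfl, h1 0 (Nat.zero_le _)]
  have : ∏ j ∈ Finset.range n, kernelS q k (P' j) (P' (j + 1)) =
      ∏ j ∈ Finset.range n, kernelS q k (P j) (P (j + 1)) := by
    refine Finset.prod_congr rfl fun j hj => ?_
    rw [Finset.mem_range] at hj
    rw [h1 j (by omega), h1 (j + 1) (by omega)]
  rw [this]
  split_ifs <;> simp

theorem measureReal_levelAt_step (hq0 : 0 < q) (hq1 : q < 1) (hξ : IsGeometricNoise q μ ξ) (k : ℕ)
    (n : ℕ) (a : ℕ → Pos ((k + 1) / 2)) (b : Pos (k / 2) × Pos ((k + 1) / 2)) :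
    μ.real {ω | (∀ j ≤ n, levelAt (ξ ω) k j = a j) ∧ pairAt (ξ ω) k (n + 1) = b} =
      μ.real {ω | ∀ j ≤ n, levelAt (ξ ω) k j = a j} * jumpWeight q k (a n) b.1 b.2 := by
  have mZ := measurable_pairAt_of_noise hξ k
  have mX : ∀ n, Measurable fun ω => levelAt (ξ ω) k n := fun n => (mZ n).snd
  set Y : Ω → Fin (n + 1) → Pos (k / 2) × Pos ((k + 1) / 2) := fun ω j => pairAt (ξ ω) k j with hY
  have mY : Measurable Y := measurable_pi_lambda _ fun j => mZ j
  have mA := measurableSet_path n (fun j _ => mX j) a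
  have mB : MeasurableSet {ω | (∀ j ≤ n, levelAt (ξ ω) k j = a j) ∧ pairAt (ξ ω) k (n + 1) = b} :=
    mA.inter (mZ (n + 1) (measurableSet_singleton b))
  refine (hasSum_measureReal_inter (μ := μ) mY mB).unique ?_
  have hs := (hasSum_measureReal_inter (μ := μ) mY mA).mul_right (jumpWeight q k (a n) b.1 b.2)
  refine Eq.mp (congrArg (fun f => HasSum f _) (funext fun Q => Eq.symm ?_)) hs
  set P : ℕ → Pos (k / 2) × Pos ((k + 1) / 2) := fun j =>
    if h : j ≤ n then Q ⟨j, by omega⟩ else b with hP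
  have hPQ : ∀ j (h : j ≤ n), P j = Q ⟨j, by omega⟩ := fun j h => dif_pos h
  have hYQ : ∀ ω, Y ω = Q ↔ ∀ j ≤ n, pairAt (ξ ω) k j = P j := by
    intro ω
    rw [funext_iff]
    constructor
    · intro h j hj
      rw [hPQ j hj, ← h]
    · intro h j
      exact (h j (by omega)).trans (hPQ j (by omega))
  by_cases hQ : ∀ j ≤ n, (P j).2 = a j
  · have e1 : {ω | ω ∈ {ω | (∀ j ≤ n, levelAt (ξ ω) k j = a j) ∧ pairAt (ξ ω) k (n + 1) = b} ∧
        Y ω = Q} = {ω | (∀ j ≤ n, pairAt (ξ ω) k j = P j) ∧ pairAt (ξ ω) k (n + 1) = b} := by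
      ext ω
      simp only [Set.mem_ofPred_eq, hYQ]
      exact ⟨fun h => ⟨h.2, h.1.2⟩, fun h => ⟨⟨fun j hj =>
        (congrArg Prod.snd (h.1 j hj)).trans (hQ j hj), h.2⟩, h.1⟩⟩
    have e2 : {ω | ω ∈ {ω | ∀ j ≤ n, levelAt (ξ ω) k j = a j} ∧ Y ω = Q} =
        {ω | ∀ j ≤ n, pairAt (ξ ω) k j = P j} := by
      ext ω
      simp only [Set.mem_ofPred_eq, hYQ]
      exact ⟨fun h => h.2, fun h => ⟨fun j hj =>
        (congrArg Prod.snd (h j hj)).trans (hQ j hj), h⟩⟩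
    rw [e1, e2, measureReal_pairAt_step hq0 hq1 hξ, kernelS, hQ n le_rfl]
  · have hne : ∀ ω, (∀ j ≤ n, levelAt (ξ ω) k j = a j) → ¬ Y ω = Q := by
      intro ω h hYQ'
      refine hQ fun j hj => ?_
      rw [← h j hj, ← (hYQ ω).1 hYQ' j hj]
      rfl
    rw [show {ω | ω ∈ {ω | (∀ j ≤ n, levelAt (ξ ω) k j = a j) ∧ pairAt (ξ ω) k (n + 1) = b} ∧
        Y ω = Q} = ∅ by ext ω; exact ⟨fun h => hne ω h.1.1 h.2, False.elim⟩,
      show {ω | ω ∈ {ω | ∀ j ≤ n, levelAt (ξ ω) k j = a j} ∧ Y ω = Q} = ∅ by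
        ext ω; exact ⟨fun h => hne ω h.1 h.2, False.elim⟩]
    simp

theorem hasSum_jumpWeight (hq0 : 0 < q) (hq1 : q < 1) (hξ : IsGeometricNoise q μ ξ) (k : ℕ)
    {y : Pos ((k + 1) / 2)} (hy : Antitone y) :
    HasSum (fun b : Pos (k / 2) × Pos ((k + 1) / 2) => jumpWeight q k y b.1 b.2) 1 := by
  obtain ⟨n, P, h0, hn, hP⟩ := exists_path k hy
  have mZ := measurable_pairAt_of_noise hξ k
  have hs := hasSum_measureReal_inter (μ := μ) (mZ (n + 1))
    (measurableSet_path n (fun j _ => mZ j) P)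
  have hpos : 0 < μ.real {ω | ∀ j ≤ n, pairAt (ξ ω) k j = P j} := by
    rw [hasPathLaw hq0 hq1 hξ k, if_pos h0]
    exact Finset.prod_pos fun j _ => jumpWeight_pos hq0 hq1 k (hP j).1 (hP j).2
  have hs' := hs.mul_left (μ.real {ω | ∀ j ≤ n, pairAt (ξ ω) k j = P j})⁻¹
  rw [inv_mul_cancel₀ hpos.ne'] at hs'
  refine Eq.mp (congrArg (fun f => HasSum f _) (funext fun b => ?_)) hs'
  rw [show {ω | ω ∈ {ω | ∀ j ≤ n, pairAt (ξ ω) k j = P j} ∧ pairAt (ξ ω) k (n + 1) = b} =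
    {ω | (∀ j ≤ n, pairAt (ξ ω) k j = P j) ∧ pairAt (ξ ω) k (n + 1) = b} from rfl,
    measureReal_pairAt_step hq0 hq1 hξ, inv_mul_cancel_left₀ hpos.ne', kernelS, hn]

theorem hasSum_kernelP (q : ℝ) (k : ℕ) (y y' : Pos ((k + 1) / 2)) :
    HasSum (fun c : Pos (k / 2) => jumpWeight q k y c y') (kernelP q k y y') := by
  refine hasSum_sum_of_ne_finset_zero fun c hc => ?_
  by_contra h
  refine hc (Fintype.mem_piFinset.2 fun i => ?_)
  exact Finset.mem_range.2 (Nat.lt_succ_of_le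
    ((interlace_of_jumpWeight_ne_zero h).1.1 i (i.castLE (by omega)) rfl))

theorem kernelP_nonneg (hq0 : 0 < q) (hq1 : q < 1) (k : ℕ) (y y' : Pos ((k + 1) / 2)) :
    0 ≤ kernelP q k y y' :=
  Finset.sum_nonneg fun _ _ => jumpWeight_nonneg hq0 hq1 k _ _ _

theorem ae_pairAt_mem (hq0 : 0 < q) (hq1 : q < 1) (hξ : IsGeometricNoise q μ ξ) (k n : ℕ) :
    ∀ᵐ ω ∂μ, pairAt (ξ ω) k n ∈ pairSpace k := by
  cases n with
  | zero =>
    refine Filter.Eventually.of_forall fun ω => ?_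
    rw [pairAt_zero]
    exact ⟨fun _ _ _ => le_rfl, fun _ _ _ => le_rfl, fun _ _ _ => le_rfl⟩
  | succ n =>
    have mZ := measurable_pairAt_of_noise hξ k
    have mX : ∀ n, Measurable fun ω => levelAt (ξ ω) k n := fun n => (mZ n).snd
    have key : ∀ b : Pos (k / 2) × Pos ((k + 1) / 2), b ∉ pairSpace k →
        μ {ω | pairAt (ξ ω) k (n + 1) = b} = 0 := by
      intro b hb
      rw [← measureReal_eq_zero_iff]
      have hs := hasSum_measureReal_inter (μ := μ)
        (measurable_pi_lambda (fun ω (j : Fin (n + 1)) => pairAt (ξ ω) k j) fun j => mZ j)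
        (mZ (n + 1) (measurableSet_singleton b))
      refine hs.unique ?_
      refine Eq.mp (congrArg (fun f => HasSum f _) (funext fun Q => ?_)) hasSum_zero
      have hsub : {ω | ω ∈ (fun ω => pairAt (ξ ω) k (n + 1)) ⁻¹' {b} ∧
          (fun j : Fin (n + 1) => pairAt (ξ ω) k j) = Q} ⊆
          {ω | (∀ j ≤ n, pairAt (ξ ω) k j = if h : j < n + 1 then Q ⟨j, h⟩ else b) ∧
            pairAt (ξ ω) k (n + 1) = b} := by
        rintro ω ⟨h1, rfl⟩
        refine ⟨fun j hj => ?_, h1⟩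
        rw [dif_pos (by omega)]
      have h0 := measureReal_pairAt_step hq0 hq1 hξ k n
        (fun j => if h : j < n + 1 then Q ⟨j, h⟩ else b) b
      have hk : ∀ p, kernelS q k p b = 0 := by
        intro p
        by_contra h
        obtain ⟨-, h2⟩ := interlace_of_jumpWeight_ne_zero h
        exact hb ⟨h2.antitone (by omega), h2⟩
      rw [hk, mul_zero] at h0
      exact (le_antisymm ((measureReal_mono hsub).trans_eq h0) measureReal_nonneg).symm
    rw [ae_iff]
    have hU : {ω | ¬ pairAt (ξ ω) k (n + 1) ∈ pairSpace k} =
        ⋃ b : {b // b ∉ pairSpace k}, {ω | pairAt (ξ ω) k (n + 1) = b} := by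
      ext ω; simp
    rw [hU, measure_iUnion_null_iff]
    exact fun b => key b b.2

theorem isMarkovChain_pairAt (hq0 : 0 < q) (hq1 : q < 1) (hξ : IsGeometricNoise q μ ξ) (k : ℕ) :
    IsMarkovChain μ (pairSpace k) (kernelS q k) (fun n ω => pairAt (ξ ω) k n) where
  nonneg _ _ _ _ := jumpWeight_nonneg hq0 hq1 k _ _ _
  hasSum_one a ha := by
    refine (hasSum_subtype_iff_of_support_subset (f := kernelS q k a) ?_).2
      (hasSum_jumpWeight hq0 hq1 hξ k ha.1)
    intro b hb
    have := (interlace_of_jumpWeight_ne_zero hb).2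
    exact ⟨this.antitone (by omega), this⟩
  measurable := measurable_pairAt_of_noise hξ k
  mem := ae_pairAt_mem hq0 hq1 hξ k
  markov n a b _ _ := measureReal_pairAt_step hq0 hq1 hξ k n a b

theorem isMarkovChain_levelAt (hq0 : 0 < q) (hq1 : q < 1) (hξ : IsGeometricNoise q μ ξ) (k : ℕ) :
    IsMarkovChain μ (levelSpace k) (kernelP q k) (fun n ω => levelAt (ξ ω) k n) where
  nonneg _ _ _ _ := kernelP_nonneg hq0 hq1 k _ _
  hasSum_one a ha := by
    have hs : HasSum (kernelP q k a) 1 := by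
      have h := (Equiv.prodComm (Pos ((k + 1) / 2)) (Pos (k / 2))).hasSum_iff.2
        (hasSum_jumpWeight hq0 hq1 hξ k ha)
      exact h.prod_fiberwise fun y' => hasSum_kernelP q k a y'
    refine (hasSum_subtype_iff_of_support_subset (f := kernelP q k a) ?_).2 hs
    intro b hb
    obtain ⟨c, -, hc⟩ := Finset.exists_ne_zero_of_sum_ne_zero hb
    exact (interlace_of_jumpWeight_ne_zero hc).2.antitone (by omega)
  measurable n := (measurable_pairAt_of_noise hξ k n).snd
  mem n := by
    filter_upwards [ae_pairAt_mem hq0 hq1 hξ k n] with ω hω using hω.1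
  markov n a b _ _ := by
    have mZ := measurable_pairAt_of_noise hξ k
    have mA : MeasurableSet {ω | (∀ j ≤ n, levelAt (ξ ω) k j = a j) ∧
        levelAt (ξ ω) k (n + 1) = b} :=
      (measurableSet_path n (fun j _ => (mZ j).snd) a).inter
        ((mZ (n + 1)).snd (measurableSet_singleton b))
    refine (hasSum_measureReal_inter (μ := μ) (mZ (n + 1)).fst mA).unique ?_
    have hs := (hasSum_kernelP q k (a n) b).mul_left
      (μ.real {ω | ∀ j ≤ n, levelAt (ξ ω) k j = a j})
    refine Eq.mp (congrArg (fun f => HasSum f _) (funext fun c => ?_)) hs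
    rw [← measureReal_levelAt_step hq0 hq1 hξ k n a (c, b)]
    congr 1
    ext ω
    simp only [Set.mem_ofPred_eq, Prod.ext_iff, pairAt]
    tauto

end final

theorem mainTheorem1 (q : ℝ) (hq0 : 0 < q) (hq1 : q < 1)
    {Ω : Type*} [MeasurableSpace Ω] (μ : Measure Ω) [IsProbabilityMeasure μ]
    (ξ : Ω → ℕ → ℕ → ℕ → ℕ)
    (hmeas : ∀ p : NoiseIndex, Measurable (fun ω => ξ ω p.1.1 p.1.2.1 p.1.2.2))
    (hindep : iIndepFun (fun (p : NoiseIndex) (ω : Ω) => ξ ω p.1.1 p.1.2.1 p.1.2.2) μ)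
    (hgeom : ∀ (p : NoiseIndex) (x : ℕ),
      μ.real {ω | ξ ω p.1.1 p.1.2.1 p.1.2.2 = x} = (1 - q) * q ^ x)
    (k : ℕ) (hk : 1 ≤ k) :
    IsMarkovChain μ (pairSpace k) (kernelS q k)
        (fun n ω => (halfLevelBefore (ξ ω) k n, levelAt (ξ ω) k n)) ∧
      IsMarkovChain μ (levelSpace k) (kernelP q k) (fun n ω => levelAt (ξ ω) k n) :=
  have hξ : IsGeometricNoise q μ ξ := ⟨hmeas, hindep, hgeom⟩
  ⟨isMarkovChain_pairAt hq0 hq1 hξ k, isMarkovChain_levelAt hq0 hq1 hξ k⟩
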